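/- Let $e$ be a Hermite--Biehler function, i.e. an entire function with $|e(z)|>|e(\bar z)|$ for $\operatorname{Im} z>0$, and assume that $e$ has no real zeros. Write $f^\#(z)=\overline{f(\bar z)}$. Let $\mathcal B$ be the de Branges space of all entire $f$ such that $f/e$ and $f^\#/e$ belong to the Hardy space $H_2(\mathbb C^+)$, with inner product $\langle g,f\rangle=\int_{\mathbb R}\overline{g(x)}f(x)\,|e(x)|^{-2}dx$ and reproducing kernel $k$. For $\beta\in\mathbb R$ put $$s_\beta(z)=\tfrac i2\left[e^{i\beta}e(z)-e^{-i\beta}e^\#(z)\right].$$ Let $S$ be the operator of multiplication by $z$ in $\mathcal B$, with domain $\operatorname{dom}(S)=\{f\in\mathcal B: zf(z)\in\mathcal B\}$. Assume that $s_0\in\mathcal B$. The canonical selfadjoint extensions of $S$ are the linear relation $S_0=\{(g(z),zg(z)+c\,s_0(z)):g\in\operatorname{dom}(S),\ c\in\mathbb C\}$ and, for $\beta\in(0,\pi)$, the operators $S_\beta$ given by $$\operatorname{dom}(S_\beta)=\left\{g(z)=\frac{s_\beta(w)f(z)-s_\beta(z)f(w)}{\sin\beta\,(z-w)}:\ f\in\mathcal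 B,\ w\in\mathbb C\right\},\qquad (S_\beta g)(z)=zg(z)+\frac{1}{\sin\beta}f(w)s_\beta(z).$$ For $\beta\in(0,\pi)$ let $E_\beta$ be the resolution of the identity of $S_\beta$ (whose spectrum is discrete), and let $m_\beta=\langle s_0,E_\beta(\cdot)s_0\rangle$, that is, the measure on $\mathbb R$ with a point mass $|s_0(x)|^2/\|k(\cdot,x)\|^2$ at each $x\in\operatorname{spec}(S_\beta)$. Let $U_\beta:L_2(\mathbb R,m_\beta)\to\mathcal B$ be the canonical isometry $$U_\beta f=f(S_\beta)s_0=\sum_{x\in\operatorname{spec}(S_\beta)}\frac{f(x)\,\langle k(\cdot,x),s_0\rangle}{\|k(\cdot,x)\|^2}\,k(\cdot,x).$$ Let $j_0$ be any real entire function (that is, $j_0^\#=j_0$) with simple zeros exactly at the points of $\operatorname{spec}(S_0)$; the quotient $s_0/j_0$ is understood as an entire function. (i) If $s_0/j_0\in\mathcal B$, then for every $\beta\in(0,\pi)$ $$\frac1{j_0}\in L_2(\mathbb R,m_\beta)\qquad\text{and}\qquad \frac{s_0}{j_0}=U_\beta\frac1{j_0}.$$ (ii) Conversely, let $\mathcal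 I\subset(0,\pi)$ be a set that has an accumulation point in $(0,\pi)$ or, provided $\operatorname{spec}(S_0)\ne\emptyset$, an accumulation point in $[0,\pi]$. If $1/j_0\in L_2(\mathbb R,m_\beta)$ for all $\beta\in\mathcal I$ and $U_\beta(1/j_0)=U_{\beta'}(1/j_0)$ for all $\beta,\beta'\in\mathcal I$, then $s_0/j_0\in\mathcal B$. -/

import Mathlib

open Complex MeasureTheory Filter Topology Set
open scoped ComplexConjugate ENNReal

/-- A Hermite-Biehler function: an entire function `e` with `|e(z)| > |e(z̄)|` for all `z` in the
open upper half-plane. -/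
structure HermiteBiehler where
  toFun : ℂ → ℂ
  entire : Differentiable ℂ toFun
  norm_conj_lt : ∀ z : ℂ, 0 < z.im → ‖toFun (conj z)‖ < ‖toFun z‖

namespace DeBranges

noncomputable section

/-- `f^#(z) = conj (f (conj z))`. -/
def sharp (f : ℂ → ℂ) : ℂ → ℂ := fun z => conj (f (conj z))

/-- `F` belongs to the Hardy space `H_2` of the open upper half-plane: it is holomorphic there and
`sup_{y > 0} ∫ |F(x + iy)|² dx < ∞`. -/
def MemHardyTwo (F : ℂ → ℂ) : Prop :=
  DifferentiableOn ℂ F {z : ℂ | 0 < z.im} ∧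
    (⨆ (y : ℝ) (_ : 0 < y), ∫⁻ x : ℝ, ‖F ((x : ℂ) + (y : ℂ) * I)‖ₑ ^ 2) < ⊤

theorem MemHardyTwo.bound {F : ℂ → ℂ} (h : MemHardyTwo F) :
    ∃ C : ℝ≥0∞, C < ⊤ ∧ ∀ y : ℝ, 0 < y → ∫⁻ x : ℝ, ‖F ((x : ℂ) + (y : ℂ) * I)‖ₑ ^ 2 ≤ C :=
  ⟨_, h.2, fun y hy => le_iSup₂_of_le y hy le_rfl⟩

theorem MemHardyTwo.of_bound {F : ℂ → ℂ} (h : DifferentiableOn ℂ F {z : ℂ | 0 < z.im})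
    {C : ℝ≥0∞} (hC : C < ⊤)
    (hb : ∀ y : ℝ, 0 < y → ∫⁻ x : ℝ, ‖F ((x : ℂ) + (y : ℂ) * I)‖ₑ ^ 2 ≤ C) : MemHardyTwo F :=
  ⟨h, lt_of_le_of_lt (iSup₂_le hb) hC⟩

theorem line_im (x y : ℝ) : ((x : ℂ) + (y : ℂ) * I).im = y := by simp

theorem MemHardyTwo.measurable_line {F : ℂ → ℂ} (h : MemHardyTwo F) {y : ℝ} (hy : 0 < y) :
    Measurable fun x : ℝ => ‖F ((x : ℂ) + (y : ℂ) * I)‖ₑ ^ 2 := by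
  have hc : Continuous fun x : ℝ => F ((x : ℂ) + (y : ℂ) * I) := by
    refine h.1.continuousOn.comp_continuous (by fun_prop) fun x => ?_
    simpa using hy
  exact (hc.measurable.enorm).pow_const 2

theorem MemHardyTwo.zero : MemHardyTwo (fun _ => 0) :=
  MemHardyTwo.of_bound (differentiableOn_const 0) (C := 0) (by simp) (by simp)

theorem MemHardyTwo.add {F G : ℂ → ℂ} (hF : MemHardyTwo F) (hG : MemHardyTwo G) :
    MemHardyTwo (fun z => F z + G z) := by
  obtain ⟨C, hC, hFb⟩ := hF.bound
  obtain ⟨D, hD, hGb⟩ := hG.bound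
  refine MemHardyTwo.of_bound (hF.1.add hG.1) (C := 2 * (C + D))
    (ENNReal.mul_lt_top (by simp) (ENNReal.add_lt_top.2 ⟨hC, hD⟩)) fun y hy => ?_
  calc ∫⁻ x : ℝ, ‖F ((x : ℂ) + (y : ℂ) * I) + G ((x : ℂ) + (y : ℂ) * I)‖ₑ ^ 2
      ≤ ∫⁻ x : ℝ, 2 * (‖F ((x : ℂ) + (y : ℂ) * I)‖ₑ ^ 2
          + ‖G ((x : ℂ) + (y : ℂ) * I)‖ₑ ^ 2) := by
        refine lintegral_mono fun x => ?_
        refine (pow_le_pow_left' (enorm_add_le _ _) 2).trans ?_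
        have := ENNReal.rpow_add_le_mul_rpow_add_rpow (‖F ((x : ℂ) + (y : ℂ) * I)‖ₑ)
          (‖G ((x : ℂ) + (y : ℂ) * I)‖ₑ) (p := 2) (by norm_num)
        norm_num at this
        simpa using this
    _ = 2 * ((∫⁻ x : ℝ, ‖F ((x : ℂ) + (y : ℂ) * I)‖ₑ ^ 2)
          + ∫⁻ x : ℝ, ‖G ((x : ℂ) + (y : ℂ) * I)‖ₑ ^ 2) := by
        rw [lintegral_const_mul' _ _ (by simp),
          lintegral_add_left (hF.measurable_line hy)]
    _ ≤ 2 * (C + D) := by gcongr <;> [exact hFb y hy; exact hGb y hy]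

theorem MemHardyTwo.const_mul {F : ℂ → ℂ} (hF : MemHardyTwo F) (c : ℂ) :
    MemHardyTwo (fun z => c * F z) := by
  obtain ⟨C, hC, hFb⟩ := hF.bound
  refine MemHardyTwo.of_bound (hF.1.const_mul c) (C := ‖c‖ₑ ^ 2 * C)
    (ENNReal.mul_lt_top (by simp) hC) fun y hy => ?_
  simp only [enorm_mul, mul_pow]
  rw [lintegral_const_mul _ (hF.measurable_line hy)]
  gcongr
  exact hFb y hy

theorem ne_zero_of_im_pos (e : HermiteBiehler) {z : ℂ} (hz : 0 < z.im) : e.toFun z ≠ 0 := by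
  intro h
  have := e.norm_conj_lt z hz
  rw [h, norm_zero] at this
  exact absurd this (not_lt.2 (norm_nonneg _))

/-- The entire functions `f` with `f / e` and `f^# / e` in `H_2` of the upper half-plane. -/
def functions (e : HermiteBiehler) : Submodule ℂ (ℂ → ℂ) where
  carrier := {f | Differentiable ℂ f ∧ MemHardyTwo (fun z => f z / e.toFun z) ∧
    MemHardyTwo (fun z => sharp f z / e.toFun z)}
  zero_mem' := by
    refine ⟨differentiable_const 0, ?_, ?_⟩
    · simpa using MemHardyTwo.zero
    · simpa [sharp] using MemHardyTwo.zero
  add_mem' := by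
    rintro f g ⟨hf, hf1, hf2⟩ ⟨hg, hg1, hg2⟩
    refine ⟨hf.add hg, ?_, ?_⟩
    · simpa [add_div] using hf1.add hg1
    · simpa [sharp, add_div] using hf2.add hg2
  smul_mem' := by
    rintro c f ⟨hf, hf1, hf2⟩
    refine ⟨hf.const_smul c, ?_, ?_⟩
    · simpa [mul_div_assoc] using hf1.const_mul c
    · simpa [sharp, mul_div_assoc] using hf2.const_mul (conj c)

/-- The de Branges space `B(e)`.  A type synonym of the submodule `functions e`, so that it carries
the topology of its norm and not that of pointwise convergence. -/
def Space (e : HermiteBiehler) : Type := ↥(functions e)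

instance (e : HermiteBiehler) : AddCommGroup (Space e) :=
  inferInstanceAs (AddCommGroup ↥(functions e))

instance (e : HermiteBiehler) : Module ℂ (Space e) := inferInstanceAs (Module ℂ ↥(functions e))

/-- The entire function underlying an element of `B(e)`. -/
def Space.toFun {e : HermiteBiehler} (f : Space e) : ℂ → ℂ :=
  Subtype.val (p := fun g => g ∈ functions e) f

/-- A function in `functions e`, as an element of `B(e)`. -/
def Space.mk {e : HermiteBiehler} (f : ℂ → ℂ) (hf : f ∈ functions e) : Space e :=
  Subtype.mk (p := fun g => g ∈ functions e) f hf

instance (e : HermiteBiehler) : CoeFun (Space e) (fun _ => ℂ → ℂ) := ⟨Space.toFun⟩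

theorem Space.mem {e : HermiteBiehler} (f : Space e) : (f : ℂ → ℂ) ∈ functions e :=
  Subtype.property (p := fun g => g ∈ functions e) f

@[simp] theorem mk_apply {e : HermiteBiehler} (f : ℂ → ℂ) (hf : f ∈ functions e) (z : ℂ) :
    Space.mk f hf z = f z := rfl

theorem Space.ext {e : HermiteBiehler} {f g : Space e} (h : ∀ z, f z = g z) : f = g :=
  Subtype.ext (funext h)

@[simp] theorem add_apply {e : HermiteBiehler} (f g : Space e) (z : ℂ) :
    (f + g) z = f z + g z := rfl

@[simp] theorem smul_apply {e : HermiteBiehler} (c : ℂ) (f : Space e) (z : ℂ) :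
    (c • f) z = c * f z := rfl

@[simp] theorem zero_apply {e : HermiteBiehler} (z : ℂ) : (0 : Space e) z = 0 := rfl

theorem memLp_div {e : HermiteBiehler} (f : Space e) :
    MemLp (fun x : ℝ => f x / e.toFun x) 2 volume := by
  have hfc : Continuous f := f.mem.1.continuous
  have hec : Continuous e.toFun := e.entire.continuous
  have hm : Measurable (fun x : ℝ => f x / e.toFun x) :=
    (hfc.comp continuous_ofReal).measurable.div (hec.comp continuous_ofReal).measurable
  refine ⟨hm.aestronglyMeasurable, ?_⟩
  rw [eLpNorm_lt_top_iff_lintegral_rpow_enorm_lt_top (by norm_num) (by norm_num)]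
  obtain ⟨C, hC, hb⟩ := f.mem.2.1.bound
  refine lt_of_le_of_lt ?_ hC
  have key : ∀ x : ℝ, ‖f x / e.toFun x‖ₑ ^ (2 : ℝ≥0∞).toReal ≤ liminf (fun n : ℕ =>
      ‖f ((x : ℂ) + ((1 / ((n : ℝ) + 1) : ℝ) : ℂ) * I) /
        e.toFun ((x : ℂ) + ((1 / ((n : ℝ) + 1) : ℝ) : ℂ) * I)‖ₑ ^ 2) atTop := by
    intro x
    by_cases hx : e.toFun x = 0
    · simp [hx]
    have h0 : Tendsto (fun n : ℕ => (x : ℂ) + ((1 / ((n : ℝ) + 1) : ℝ) : ℂ) * I) atTop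
        (𝓝 ((x : ℂ) + ((0 : ℝ) : ℂ) * I)) := by
      refine tendsto_const_nhds.add (Tendsto.mul_const I ?_)
      exact (continuous_ofReal.tendsto 0).comp tendsto_one_div_add_atTop_nhds_zero_nat
    simp only [ofReal_zero, zero_mul, add_zero] at h0
    have h1 := ((hfc.tendsto (x : ℂ)).comp h0).div ((hec.tendsto (x : ℂ)).comp h0) hx
    have h2 := (((ENNReal.continuous_pow 2).comp continuous_enorm).tendsto _).comp h1
    have h3 := h2.liminf_eq
    simp only [Function.comp_def, Pi.div_apply] at h3
    rw [h3]
    simp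
  calc ∫⁻ x : ℝ, ‖f x / e.toFun x‖ₑ ^ (2 : ℝ≥0∞).toReal
      ≤ ∫⁻ x : ℝ, liminf (fun n : ℕ =>
      ‖f ((x : ℂ) + ((1 / ((n : ℝ) + 1) : ℝ) : ℂ) * I) /
        e.toFun ((x : ℂ) + ((1 / ((n : ℝ) + 1) : ℝ) : ℂ) * I)‖ₑ ^ 2) atTop := lintegral_mono key
    _ ≤ liminf (fun n : ℕ => ∫⁻ x : ℝ,
      ‖f ((x : ℂ) + ((1 / ((n : ℝ) + 1) : ℝ) : ℂ) * I) /
        e.toFun ((x : ℂ) + ((1 / ((n : ℝ) + 1) : ℝ) : ℂ) * I)‖ₑ ^ 2) atTop :=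
        lintegral_liminf_le fun n => f.mem.2.1.measurable_line (by positivity)
    _ ≤ C := by
        refine (liminf_le_liminf (Eventually.of_forall fun n => hb _ (by positivity))).trans ?_
        simp

theorem integrable_inner {e : HermiteBiehler} (g f : Space e) :
    Integrable (fun x : ℝ => conj (g x) * f x / ((‖e.toFun x‖ : ℂ) ^ 2)) volume := by
  have h := (memLp_div g).star.integrable_mul (memLp_div f)
  refine h.congr (Eventually.of_forall fun x => ?_)
  simp only [Pi.mul_apply, Pi.star_apply, RCLike.star_def, map_div₀]
  rw [← Complex.conj_mul']
  ring

theorem eq_zero_of_inner_self {e : HermiteBiehler} (f : Space e)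
    (h : ∫ x : ℝ, conj (f x) * f x / ((‖e.toFun x‖ : ℂ) ^ 2) = 0) : f = 0 := by
  have hfd : Differentiable ℂ f := f.mem.1
  have hre : ∫ x : ℝ, ‖f x‖ ^ 2 / ‖e.toFun x‖ ^ 2 = 0 := by
    have : (fun x : ℝ => conj (f x) * f x / ((‖e.toFun x‖ : ℂ) ^ 2)) =
        fun x : ℝ => ((‖f x‖ ^ 2 / ‖e.toFun x‖ ^ 2 : ℝ) : ℂ) := by
      funext x
      rw [Complex.conj_mul']
      push_cast
      rfl
    rw [this, integral_complex_ofReal] at h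
    exact_mod_cast h
  have hint : Integrable (fun x : ℝ => ‖f x‖ ^ 2 / ‖e.toFun x‖ ^ 2) := by
    have := (integrable_inner f f).norm
    refine this.congr (Eventually.of_forall fun x => ?_)
    simp [pow_two]
  have hae := (integral_eq_zero_iff_of_nonneg (fun x => by positivity) hint).1 hre
  have hprod : (fun x : ℝ => f x * e.toFun x) =ᵐ[volume] fun _ => 0 := by
    filter_upwards [hae] with x hx
    simp only [Pi.zero_apply, div_eq_zero_iff, ne_eq, OfNat.ofNat_ne_zero, not_false_eq_true,
      pow_eq_zero_iff, norm_eq_zero] at hx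
    rcases hx with hx | hx <;> simp [hx]
  have hpe : Differentiable ℂ fun z => f z * e.toFun z := hfd.mul e.entire
  have hR := Continuous.ae_eq_iff_eq (μ := (volume : Measure ℝ))
    (hpe.continuous.comp continuous_ofReal) continuous_const |>.1 hprod
  have hfreq : ∃ᶠ z in 𝓝[≠] (0 : ℂ), f z * e.toFun z = 0 := by
    have ht : Tendsto (fun x : ℝ => (x : ℂ)) (𝓝[≠] 0) (𝓝[≠] (0 : ℂ)) := by
      refine tendsto_nhdsWithin_iff.2 ⟨?_, ?_⟩
      · exact (continuous_ofReal.tendsto' 0 0 (by simp)).mono_left nhdsWithin_le_nhds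
      · filter_upwards [self_mem_nhdsWithin] with x hx
        simpa using hx
    refine ht.frequently (Eventually.frequently (Eventually.of_forall fun x => ?_))
    exact congrFun hR x
  have hz : (fun z => f z * e.toFun z) = 0 :=
    AnalyticOnNhd.eq_of_frequently_eq (fun z _ => hpe.analyticAt z)
      (fun z _ => analyticAt_const) hfreq
  have hf0 : (f : ℂ → ℂ) = 0 := by
    refine AnalyticOnNhd.eq_of_eventuallyEq (z₀ := I) (fun z _ => hfd.analyticAt z)
      (fun z _ => analyticAt_const) ?_
    have : {z : ℂ | 0 < z.im} ∈ 𝓝 I :=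
      (isOpen_lt continuous_const continuous_im).mem_nhds (by simp)
    filter_upwards [this] with z hzI
    exact (mul_eq_zero.1 (congrFun hz z)).resolve_right (ne_zero_of_im_pos e hzI)
  exact Space.ext fun z => congrFun hf0 z

/-- The inner product `⟨g, f⟩ = ∫ conj (g x) f(x) / |e(x)|² dx` of `B(e)`. -/
abbrev innerCore (e : HermiteBiehler) : InnerProductSpace.Core ℂ (Space e) where
  inner g f := ∫ x : ℝ, conj (g x) * f x / ((‖e.toFun x‖ : ℂ) ^ 2)
  conj_inner_symm g f := by
    rw [← integral_conj]
    congr 1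
    funext x
    simp [mul_comm]
  re_inner_nonneg f := by
    have : (fun x : ℝ => conj (f x) * f x / ((‖e.toFun x‖ : ℂ) ^ 2)) =
        fun x : ℝ => ((‖f x‖ ^ 2 / ‖e.toFun x‖ ^ 2 : ℝ) : ℂ) := by
      funext x
      rw [Complex.conj_mul']
      push_cast
      rfl
    rw [this, integral_complex_ofReal]
    simpa using integral_nonneg fun x : ℝ => by positivity
  add_left f g h := by
    rw [← integral_add (integrable_inner f h) (integrable_inner g h)]
    congr 1
    funext x
    simp
    ring
  smul_left f g c := by
    rw [← integral_const_mul]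
    congr 1
    funext x
    simp
    ring
  definite f hf := eq_zero_of_inner_self f hf

instance (e : HermiteBiehler) : NormedAddCommGroup (Space e) :=
  (innerCore e).toNormedAddCommGroup

instance (e : HermiteBiehler) : InnerProductSpace ℂ (Space e) :=
  InnerProductSpace.ofCore (innerCore e).toCore

/-- The associated functions `s_β(z) = (i/2) [e^{iβ} e(z) - e^{-iβ} e^#(z)]`. -/
def s (e : HermiteBiehler) (β : ℝ) (z : ℂ) : ℂ :=
  I / 2 * (exp (I * β) * e.toFun z - exp (-(I * β)) * sharp e.toFun z)

/-- The selfadjoint operator extension `S_β`, `β ∈ (0, π)`, of multiplication by the independent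
variable, given by its graph: the pairs `(g, S_β g)` where, for some `f ∈ B` and `w ∈ ℂ`,
`g(z) = (s_β(w) f(z) - s_β(z) f(w)) / (sin β (z - w))` and
`(S_β g)(z) = z g(z) + f(w) s_β(z) / sin β`. -/
def opS (e : HermiteBiehler) (β : ℝ) : Set (Space e × Space e) :=
  {p | ∃ (f : Space e) (w : ℂ),
    (∀ z, z ≠ w → p.1 z = (s e β w * f z - s e β z * f w) / (Real.sin β * (z - w))) ∧
    ∀ z, p.2 z = z * p.1 z + 1 / Real.sin β * f w * s e β z}

/-- The remaining selfadjoint extension (for `s_0 ∈ B`), the linear relation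
`S_0 = {(g(z), z g(z) + c s_0(z)) : g ∈ dom S, c ∈ ℂ}`, where `g ∈ dom S` means that `g(z)` and
`z g(z)` are in `B`. -/
def relS0 (e : HermiteBiehler) : Set (Space e × Space e) :=
  {p | (fun z => z * p.1 z) ∈ functions e ∧ ∃ c : ℂ, ∀ z, p.2 z = z * p.1 z + c * s e 0 z}

/-- The spectrum of a linear relation `T` (in particular of the graph of an unbounded operator): the
complement of the set of `l` for which `(T - l)⁻¹ = {(v - l u, u) : (u, v) ∈ T}` is the graph of an
everywhere defined bounded operator `R`. -/
def relSpectrum {E : Type*} [NormedAddCommGroup E] [NormedSpace ℂ E] (T : Set (E × E)) : Set ℂ :=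
  {l | ¬ ∃ R : E →L[ℂ] E, ∀ u v : E, (u, v) ∈ T ↔ u = R (v - l • u)}

/-- The eigenspace `ker (S_β - x)`; taking the span changes nothing for the linear operator
`S_β`. -/
def eigenspace (e : HermiteBiehler) (β x : ℝ) : Submodule ℂ (Space e) :=
  Submodule.span ℂ {g | (g, (x : ℂ) • g) ∈ opS e β}

instance (e : HermiteBiehler) (β x : ℝ) : FiniteDimensional ℂ (eigenspace e β x) := by
  have hext : ∀ g g' : Space e, (∀ z : ℂ, (z - x) * g z = (z - x) * g' z) → g = g' := by
    intro g g' h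
    have hg : Continuous g := g.mem.1.continuous
    have hg' : Continuous g' := g'.mem.1.continuous
    refine Space.ext fun z => ?_
    have hd : Dense ({(x : ℂ)}ᶜ : Set ℂ) := dense_compl_singleton _
    refine congrFun (Continuous.ext_on hd hg hg' fun y hy => ?_) z
    exact mul_left_cancel₀ (sub_ne_zero.2 hy) (h y)
  have hform : ∀ g : Space e, (g, (x : ℂ) • g) ∈ opS e β →
      ∃ c : ℂ, ∀ z, (z - x) * g z = c * s e β z := by
    rintro g ⟨f, w, -, h⟩
    refine ⟨-(1 / Real.sin β * f w), fun z => ?_⟩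
    have := h z
    simp only [smul_apply] at this
    linear_combination -this
  suffices h : ∃ g₀ : Space e, eigenspace e β x ≤ Submodule.span ℂ {g₀} by
    obtain ⟨g₀, h⟩ := h
    exact Submodule.finiteDimensional_of_le h
  by_cases H : ∃ g₀ : Space e, ∃ c : ℂ, c ≠ 0 ∧ ∀ z, (z - x) * g₀ z = c * s e β z
  · obtain ⟨g₀, c, hc, hg₀⟩ := H
    refine ⟨g₀, Submodule.span_le.2 fun g hg => ?_⟩
    obtain ⟨d, hd⟩ := hform g hg
    refine Submodule.mem_span_singleton.2 ⟨d / c, (hext _ _ fun z => ?_).symm⟩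
    rw [hd z, smul_apply, mul_left_comm, hg₀ z]
    field_simp
  · push Not at H
    refine ⟨0, Submodule.span_le.2 fun g hg => ?_⟩
    obtain ⟨d, hd⟩ := hform g hg
    have hd0 : d = 0 := by
      by_contra hne
      obtain ⟨z, hz⟩ := H g d hne
      exact hz (hd z)
    have : g = 0 := hext _ _ fun z => by simp [hd z, hd0]
    simp [this]

/-- The value `E_β({x})` of the resolution of the identity of `S_β` at a point: the orthogonal
projection onto `ker (S_β - x)`. -/
def E (e : HermiteBiehler) (β x : ℝ) : Space e →L[ℂ] Space e :=
  (eigenspace e β x).starProjection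

/-- `spec(S_β)` as a set of reals (`S_β` is selfadjoint, so its spectrum is real). -/
def realSpec (e : HermiteBiehler) (β : ℝ) : Set ℝ := {x : ℝ | (x : ℂ) ∈ relSpectrum (opS e β)}

/-- The spectral measure `⟨v, E_β(·) v⟩`. As the spectrum of `S_β` is discrete, it is the sum over
`x ∈ spec(S_β)` of the point masses `⟨v, E_β({x}) v⟩` at `x`. -/
def spectralMeasure (e : HermiteBiehler) (β : ℝ) (v : Space e) : Measure ℝ :=
  Measure.sum fun x : realSpec e β => ENNReal.ofReal (inner ℂ v (E e β x v)).re • Measure.dirac x.1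

/-- `f(S_β) v = ∫ f(t) dE_β(t) v = ∑_{x ∈ spec(S_β)} f(x) E_β({x}) v`, the (orthogonal) series being
convergent in `B` when `f` is square integrable for `⟨v, E_β(·) v⟩`. -/
def funCalc (e : HermiteBiehler) (β : ℝ) (f : ℝ → ℂ) (v : Space e) : Space e :=
  ∑' x : realSpec e β, f x • E e β x v

/-- `m_β = ⟨s_0, E_β(·) s_0⟩`. Each `ker (S_β - x)` is spanned by the reproducing kernel `k(·, x)`,
so that `m_β` has mass `|s_0(x)|² / ‖k(·, x)‖²` at `x ∈ spec(S_β)`. -/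
def m (e : HermiteBiehler) (hs : s e 0 ∈ functions e) (β : ℝ) : Measure ℝ :=
  spectralMeasure e β (Space.mk (s e 0) hs)

/-- The canonical isometry `U_β f = f(S_β) s_0`, for `f ∈ L_2(ℝ, m_β)`. -/
def U (e : HermiteBiehler) (hs : s e 0 ∈ functions e) (β : ℝ) (f : ℝ → ℂ) : Space e :=
  funCalc e β f (Space.mk (s e 0) hs)

/-- `j` is a real entire function whose zeros are simple and form exactly the set `Z`. -/
structure IsRealEntireWithSimpleZeros (j : ℂ → ℂ) (Z : Set ℂ) : Prop where
  entire : Differentiable ℂ j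
  real : ∀ z, conj (j (conj z)) = j z
  zeros : ∀ z, j z = 0 ↔ z ∈ Z
  simple : ∀ z, j z = 0 → deriv j z ≠ 0

end

end DeBranges

/-! ### Contour shifts for Hardy functions in the upper half-plane. -/

namespace DeBranges

/-! For `β ∈ (0, π)` the spectrum of `S_β` is the zero set of `s_β`, and the eigenvectors `s_β(z)/(z
- x)` are multiples of the reproducing kernels at these zeros. Once they are known to form an
orthogonal basis, an element of `B(e)` is determined by its values at the zeros of `s_β`, and `U_β
f` is the element with values `f(x) s_0(x)` there (`U_apply`).

Direct part: `G = s_0/j` has the values `s_0(x)/j(x)` on `spec(S_β)`, so its coefficients in the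
eigenbasis are `1/j(x)` times those of `s_0`. Bessel's inequality gives the square integrability and
the expansion of `G` is `U_β (1/j)` (`quotient_eq_U`).

Converse: the common element `G = U_β (1/j)` satisfies `G j = s_0` at every zero of every `s_β` with
`β` in the index set. The zeros of `s_β` move continuously with `β`: as `β` accumulates at `γ`, they
accumulate at each zero of `s_γ` (`frequently_eq_zero`). The identity theorem then gives `G j = s_0`
everywhere (`exists_quotient`). All that is needed is a zero of `s_γ`. For `γ` in the open interval
there always is one. At `0` and `π` it is a point of `spec(S_0)`.

The main work is completeness of the eigenvectors (`vanishing_eq_bot`). On the closed subspace of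
functions vanishing at all zeros of `s_β`, the inverse of `S_β` is everywhere defined, symmetric,
and has no nonzero spectrum, hence is zero. An element of that subspace is then a multiple of `s_β`,
which is not in `B(e)` because `s_0` is. Symmetry comes from a Cauchy-type fact: an `H_2` function
divided by `z - w`, without a pole at `w`, has integral zero over the real line. The same fact
yields the Poisson formula, hence bounded point evaluations and completeness of `B(e)`. -/

theorem exists_ge_lt_of_integrable {v : ℝ → ℝ} (hv : Integrable v) {ε : ℝ} (hε : 0 < ε) (a : ℝ) :
    ∃ R, a < R ∧ v R < ε := by
  by_contra! h
  have h1 := hv.measure_norm_ge_lt_top hε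
  have h2 : volume (Ioi a) ≤ volume {x | ε ≤ ‖v x‖} :=
    measure_mono fun x hx => (h x hx).trans (le_abs_self _)
  rw [Real.volume_Ioi] at h2
  exact absurd (lt_of_le_of_lt h2 h1) (lt_irrefl _)

/-- Reflection of the height extends `G` continuously to the whole plane, which makes measurability
on products immediate. -/
theorem continuous_comp_abs_im {G : ℂ → ℂ} (hc : ContinuousOn G {z : ℂ | 0 ≤ z.im}) :
    Continuous fun p : ℝ × ℝ => G ((p.1 : ℂ) + ((|p.2| : ℝ) : ℂ) * I) := by
  refine hc.comp_continuous (by fun_prop) fun p => ?_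
  simp

theorem continuous_horizontal {G : ℂ → ℂ} (hc : ContinuousOn G {z : ℂ | 0 ≤ z.im}) {y : ℝ}
    (hy : 0 ≤ y) : Continuous fun t : ℝ => G ((t : ℂ) + (y : ℂ) * I) := by
  refine hc.comp_continuous (by fun_prop) fun p => ?_
  simpa using hy

/-- The integrals of a function of Hardy class `H_1` over horizontal lines agree. -/
theorem integral_horizontal_eq {G : ℂ → ℂ} (hc : ContinuousOn G {z : ℂ | 0 ≤ z.im})
    (hd : DifferentiableOn ℂ G {z : ℂ | 0 < z.im}) {C : ℝ≥0∞} (hC : C < ⊤)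
    (hb : ∀ y : ℝ, 0 ≤ y → ∫⁻ t : ℝ, ‖G ((t : ℂ) + (y : ℂ) * I)‖ₑ ≤ C) {Y : ℝ} (hY : 0 < Y) :
    ∫ t : ℝ, G t = ∫ t : ℝ, G ((t : ℂ) + (Y : ℂ) * I) := by
  have hint : ∀ y : ℝ, 0 ≤ y → Integrable fun t : ℝ => G ((t : ℂ) + (y : ℂ) * I) := fun y hy =>
    ⟨(continuous_horizontal hc hy).aestronglyMeasurable, lt_of_le_of_lt (hb y hy) hC⟩
  have hi0 : Integrable fun t : ℝ => G t := by simpa using hint 0 le_rfl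
  have hiY := hint Y hY.le
  have hprod : Integrable (fun p : ℝ × ℝ => G ((p.1 : ℂ) + ((|p.2| : ℝ) : ℂ) * I))
      ((volume : Measure ℝ).prod (volume.restrict (Ioc 0 Y))) := by
    refine ⟨(continuous_comp_abs_im hc).aestronglyMeasurable, ?_⟩
    rw [HasFiniteIntegral, lintegral_prod_symm _
      (continuous_comp_abs_im hc).enorm.measurable.aemeasurable]
    calc ∫⁻ y in Ioc 0 Y, ∫⁻ t : ℝ, ‖G ((t : ℂ) + ((|y| : ℝ) : ℂ) * I)‖ₑ
        ≤ ∫⁻ y in Ioc 0 Y, C := lintegral_mono fun y => hb _ (abs_nonneg y)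
      _ < ⊤ := by
        rw [lintegral_const]
        exact ENNReal.mul_lt_top hC (by simp)
  -- By Fubini the integral of `‖G‖` over the vertical side at abscissa `R` is integrable in `R`.
  -- Hence it is small on both sides of suitable, arbitrarily wide rectangles, which is enough since
  -- the horizontal integrals converge.
  have hv := hprod.norm.integral_prod_left
  set v : ℝ → ℝ := fun R => ∫ y in Ioc 0 Y, ‖G ((R : ℂ) + ((|y| : ℝ) : ℂ) * I)‖ with hvdef
  have hvint : ∀ R : ℝ, ‖∫ y in (0 : ℝ)..Y, G ((R : ℂ) + (y : ℂ) * I)‖ ≤ v R := by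
    intro R
    rw [intervalIntegral.integral_of_le hY.le]
    refine (norm_integral_le_integral_norm _).trans (le_of_eq ?_)
    refine setIntegral_congr_fun measurableSet_Ioc fun y hy => ?_
    simp only [abs_of_pos hy.1]
  have hvv : Integrable fun R => v R + v (-R) := hv.add hv.comp_neg
  have hrect : ∀ R : ℝ, 0 < R → ‖(∫ t in (-R)..R, G t) -
      ∫ t in (-R)..R, G ((t : ℂ) + (Y : ℂ) * I)‖ ≤ v R + v (-R) := by
    intro R hR
    have h := integral_boundary_rect_eq_zero_of_continuousOn_of_differentiableOn G
      ((-R : ℝ) : ℂ) ((R : ℂ) + (Y : ℂ) * I) (hc.mono ?_) (hd.mono ?_)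
    · simp only [ofReal_re, ofReal_im, add_re, mul_re, I_re, mul_zero, I_im, mul_one, sub_self,
        add_zero, add_im, mul_im, zero_add, ofReal_zero, zero_mul, smul_eq_mul] at h
      have h' : (∫ t in (-R)..R, G t) - ∫ t in (-R)..R, G ((t : ℂ) + (Y : ℂ) * I) =
          I * (∫ y in (0 : ℝ)..Y, G (((-R : ℝ) : ℂ) + (y : ℂ) * I)) -
          I * ∫ y in (0 : ℝ)..Y, G ((R : ℂ) + (y : ℂ) * I) := by
        linear_combination h
      rw [h']
      refine (norm_sub_le _ _).trans ?_
      rw [norm_mul, norm_mul, norm_I, one_mul, one_mul, add_comm]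
      exact add_le_add (hvint R) (hvint (-R))
    · intro z hz
      have := hz.2
      simp only [ofReal_im, add_im, mul_im, ofReal_re, I_re, I_im, mul_one, mul_zero, add_zero,
        zero_add, mem_preimage, uIcc_of_le hY.le] at this
      exact this.1
    · intro z hz
      have := hz.2
      simp only [ofReal_im, add_im, mul_im, ofReal_re, I_re, I_im, mul_one, mul_zero, add_zero,
        zero_add, mem_preimage, min_eq_left hY.le] at this
      exact this.1
  have hlim : Tendsto (fun R : ℝ => ‖(∫ t in (-R)..R, G t) -
      ∫ t in (-R)..R, G ((t : ℂ) + (Y : ℂ) * I)‖) atTop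
      (𝓝 ‖(∫ t : ℝ, G t) - ∫ t : ℝ, G ((t : ℂ) + (Y : ℂ) * I)‖) :=
    ((intervalIntegral_tendsto_integral hi0 tendsto_neg_atTop_atBot tendsto_id).sub
      (intervalIntegral_tendsto_integral hiY tendsto_neg_atTop_atBot tendsto_id)).norm
  by_contra hne
  have hpos : 0 < ‖(∫ t : ℝ, G t) - ∫ t : ℝ, G ((t : ℂ) + (Y : ℂ) * I)‖ :=
    norm_pos_iff.2 (sub_ne_zero.2 hne)
  obtain ⟨a, ha⟩ := eventually_atTop.1
    ((hlim.eventually (lt_mem_nhds (half_lt_self hpos))).and (eventually_gt_atTop 0))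
  obtain ⟨R, hR, hvR⟩ := exists_ge_lt_of_integrable hvv (half_pos hpos) a
  have h1 := ha R hR.le
  linarith [hrect R h1.2, h1.1]

theorem lintegral_ofReal_inv_sq_add_sq (x : ℝ) {a : ℝ} (ha : 0 < a) :
    ∫⁻ t : ℝ, ENNReal.ofReal (1 / ((t - x) ^ 2 + a ^ 2)) = ENNReal.ofReal (Real.pi / a) := by
  lift a to NNReal using ha.le
  have ha' : 0 < a := by exact_mod_cast ha
  have h := ProbabilityTheory.lintegral_cauchyPDF_eq_one x ha'.ne'
  have h2 : ∀ t : ℝ, ENNReal.ofReal (1 / ((t - x) ^ 2 + a ^ 2)) =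
      ENNReal.ofReal (Real.pi / a) * ProbabilityTheory.cauchyPDF x a t := by
    intro t
    rw [ProbabilityTheory.cauchyPDF_def, ProbabilityTheory.cauchyPDFReal_def,
      ← ENNReal.ofReal_mul (by positivity)]
    congr 1
    field_simp
  simp_rw [h2]
  rw [lintegral_const_mul _ (by fun_prop), h, mul_one]

theorem norm_add_mul_I_sub_sq (x t y : ℝ) (w : ℂ) (hx : w.re = x) :
    ‖((t : ℂ) + (y : ℂ) * I) - w‖ ^ 2 = (t - x) ^ 2 + (y - w.im) ^ 2 := by
  rw [← normSq_eq_norm_sq, normSq_apply]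
  simp [hx]
  ring

/-- A function in `H_2` of the half-plane, divided by `z - w`, has integral zero over the real
line, if the quotient has no pole at `w`. -/
theorem integral_eq_zero_of_norm_sub_mul_le {G F : ℂ → ℂ}
    (hc : ContinuousOn G {z : ℂ | 0 ≤ z.im}) (hd : DifferentiableOn ℂ G {z : ℂ | 0 < z.im})
    {C : ℝ≥0∞} (hC : C < ⊤)
    (hb : ∀ y : ℝ, 0 ≤ y → ∫⁻ t : ℝ, ‖F ((t : ℂ) + (y : ℂ) * I)‖ₑ ^ 2 ≤ C) (w : ℂ)
    (hGF : ∀ z : ℂ, 0 ≤ z.im → ‖z - w‖ * ‖G z‖ ≤ ‖F z‖) :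
    Integrable (fun t : ℝ => G t) ∧ ∫ t : ℝ, G t = 0 := by
  obtain ⟨M, hM⟩ : ∃ M : ℝ, ∀ z : ℂ, 0 ≤ z.im → ‖z - w‖ ≤ 1 → ‖G z‖ ≤ M := by
    have hK : IsCompact (Metric.closedBall w 1 ∩ {z : ℂ | 0 ≤ z.im}) :=
      (isCompact_closedBall w 1).inter_right (isClosed_le continuous_const continuous_im)
    obtain ⟨M, hM⟩ := hK.exists_bound_of_continuousOn (hc.mono inter_subset_right)
    exact ⟨M, fun z hz hzw => hM z ⟨by simpa [dist_eq_norm] using hzw, hz⟩⟩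
  set M' := max M 0
  have hM'0 : 0 ≤ M' := le_max_right _ _
  have hM' : ∀ z : ℂ, 0 ≤ z.im → ‖z - w‖ ≤ 1 → ‖G z‖ ≤ M' := fun z hz h =>
    (hM z hz h).trans (le_max_left _ _)
  -- Within distance `1` of `w` the weight `1 / ((t - w.re)² + 1)` is at least `1/2`, which absorbs
  -- the bound `M'`. Farther away, `‖F‖ / ‖z - w‖` is split by the arithmetic-geometric mean
  -- inequality.
  have hpt : ∀ y : ℝ, 0 ≤ y → ∀ t : ℝ, ‖G ((t : ℂ) + (y : ℂ) * I)‖ ≤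
      ‖F ((t : ℂ) + (y : ℂ) * I)‖ ^ 2 + (2 * M' + 2) * (1 / ((t - w.re) ^ 2 + 1 ^ 2)) := by
    intro y hy t
    have hz : 0 ≤ ((t : ℂ) + (y : ℂ) * I).im := by simpa using hy
    have hn := norm_add_mul_I_sub_sq w.re t y w rfl
    set z := (t : ℂ) + (y : ℂ) * I
    have hu : 0 < (t - w.re) ^ 2 + 1 ^ 2 := by positivity
    rcases le_or_gt ‖z - w‖ 1 with h | h
    · have h1 : (t - w.re) ^ 2 ≤ 1 := by nlinarith [norm_nonneg (z - w), sq_nonneg (y - w.im)]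
      have h2 : M' ≤ (2 * M' + 2) * (1 / ((t - w.re) ^ 2 + 1 ^ 2)) := by
        rw [mul_one_div, le_div_iff₀ hu]
        nlinarith
      linarith [hM' z hz h, sq_nonneg ‖F z‖]
    · have h0 := hGF z hz
      have h1 : 1 / ‖z - w‖ ^ 2 ≤ 2 * (1 / ((t - w.re) ^ 2 + 1 ^ 2)) := by
        rw [mul_one_div, div_le_div_iff₀ (by positivity) hu]
        nlinarith [sq_nonneg (y - w.im)]
      have h2 : ‖G z‖ ≤ ‖F z‖ * (1 / ‖z - w‖) := by
        rw [mul_one_div, le_div_iff₀ (by positivity)]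
        linarith
      have h3 : (1 / ‖z - w‖) ^ 2 = 1 / ‖z - w‖ ^ 2 := by rw [div_pow, one_pow]
      have h4 : 0 ≤ M' * (1 / ((t - w.re) ^ 2 + 1 ^ 2)) := by positivity
      nlinarith [sq_nonneg (‖F z‖ - 1 / ‖z - w‖), sq_nonneg ‖F z‖, sq_nonneg (1 / ‖z - w‖)]
  have hb1 : ∀ y : ℝ, 0 ≤ y → ∫⁻ t : ℝ, ‖G ((t : ℂ) + (y : ℂ) * I)‖ₑ ≤
      C + ENNReal.ofReal (2 * M' + 2) * ENNReal.ofReal (Real.pi / 1) := by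
    intro y hy
    rw [← lintegral_ofReal_inv_sq_add_sq w.re one_pos,
      ← lintegral_const_mul _ (by fun_prop)]
    refine le_trans ?_ (add_le_add_left (hb y hy) _)
    rw [← lintegral_add_right _ (by fun_prop)]
    refine lintegral_mono fun t => ?_
    rw [← ENNReal.ofReal_mul (by positivity), ← ofReal_norm, ← ofReal_norm,
      ← ENNReal.ofReal_pow (norm_nonneg _), ← ENNReal.ofReal_add (by positivity) (by positivity)]
    exact ENNReal.ofReal_le_ofReal (hpt y hy t)
  have hD : C + ENNReal.ofReal (2 * M' + 2) * ENNReal.ofReal (Real.pi / 1) < ⊤ :=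
    ENNReal.add_lt_top.2 ⟨hC, ENNReal.mul_lt_top (by simp) (by simp)⟩
  refine ⟨⟨?_, lt_of_le_of_lt (by simpa using hb1 0 le_rfl) hD⟩, ?_⟩
  · have := continuous_horizontal hc le_rfl
    simp only [ofReal_zero, zero_mul, add_zero] at this
    exact this.aestronglyMeasurable
  -- On a line at height at least `n²` above `w`, the weighted inequality `‖F‖/‖z - w‖ ≤ ‖F‖²/n +
  -- n/‖z - w‖²` bounds the integral by `C/n + n · π/n²`, which tends to zero.
  have hsmall : ∀ n : ℕ, 0 < n →
      ‖∫ t : ℝ, G t‖ₑ ≤ ENNReal.ofReal (1 / n) * (C + ENNReal.ofReal Real.pi) := by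
    intro n hn
    have hn' : (0 : ℝ) < n := Nat.cast_pos.2 hn
    set Y : ℝ := max w.im 0 + n ^ 2
    have hY : 0 < Y := by positivity
    have hYw : (n : ℝ) ^ 2 ≤ Y - w.im := by
      simp only [Y]
      linarith [le_max_left w.im 0]
    rw [integral_horizontal_eq hc hd hD hb1 hY]
    refine (enorm_integral_le_lintegral_enorm _).trans ?_
    calc ∫⁻ t : ℝ, ‖G ((t : ℂ) + (Y : ℂ) * I)‖ₑ
        ≤ ∫⁻ t : ℝ, (ENNReal.ofReal (1 / n) * ‖F ((t : ℂ) + (Y : ℂ) * I)‖ₑ ^ 2 +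
          ENNReal.ofReal n * ENNReal.ofReal (1 / ((t - w.re) ^ 2 + (n ^ 2 : ℝ) ^ 2))) := by
          refine lintegral_mono fun t => ?_
          rw [← ofReal_norm, ← ofReal_norm,
            ← ENNReal.ofReal_pow (norm_nonneg _), ← ENNReal.ofReal_mul (by positivity),
            ← ENNReal.ofReal_mul (by positivity),
            ← ENNReal.ofReal_add (by positivity) (by positivity)]
          refine ENNReal.ofReal_le_ofReal ?_
          have hg := hGF ((t : ℂ) + (Y : ℂ) * I) (by simpa using hY.le)
          have hnn := norm_add_mul_I_sub_sq w.re t Y w rfl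
          set z := (t : ℂ) + (Y : ℂ) * I
          have hle : (t - w.re) ^ 2 + ((n : ℝ) ^ 2) ^ 2 ≤ ‖z - w‖ ^ 2 := by
            rw [hnn]
            gcongr
          have hq : 0 < (t - w.re) ^ 2 + ((n : ℝ) ^ 2) ^ 2 := by positivity
          have hzw : 0 < ‖z - w‖ := by
            by_contra hcon
            have : ‖z - w‖ = 0 := le_antisymm (not_lt.1 hcon) (norm_nonneg _)
            rw [this] at hle
            linarith
          have h2 : ‖G z‖ ≤ ‖F z‖ * (1 / ‖z - w‖) := by
            rw [mul_one_div, le_div_iff₀ (by positivity)]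
            linarith
          have h1 : (1 / ‖z - w‖) ^ 2 ≤ 1 / ((t - w.re) ^ 2 + ((n : ℝ) ^ 2) ^ 2) := by
            rw [div_pow, one_pow]
            exact one_div_le_one_div_of_le hq hle
          have h3 : ‖F z‖ * (1 / ‖z - w‖) ≤ 1 / n * ‖F z‖ ^ 2 + n * (1 / ‖z - w‖) ^ 2 := by
            have e1 : 1 / n * ‖F z‖ ^ 2 + n * (1 / ‖z - w‖) ^ 2 =
              n * ((‖F z‖ / n) ^ 2 + (1 / ‖z - w‖) ^ 2) := by field_simp
            have e2 : ‖F z‖ * (1 / ‖z - w‖) = n * ((‖F z‖ / n) * (1 / ‖z - w‖)) := by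
              field_simp
            rw [e1, e2]
            gcongr
            nlinarith [sq_nonneg (‖F z‖ / n - 1 / ‖z - w‖), sq_nonneg (‖F z‖ / n),
              sq_nonneg (1 / ‖z - w‖)]
          have h4 : (n : ℝ) * (1 / ‖z - w‖) ^ 2 ≤
            n * (1 / ((t - w.re) ^ 2 + ((n : ℝ) ^ 2) ^ 2)) := by gcongr
          linarith
      _ ≤ ENNReal.ofReal (1 / n) * C +
          ENNReal.ofReal n * ENNReal.ofReal (Real.pi / n ^ 2) := by
          rw [lintegral_add_right _ (by fun_prop), lintegral_const_mul' _ _ (by simp),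
            lintegral_const_mul' _ _ (by simp), lintegral_ofReal_inv_sq_add_sq _ (by positivity)]
          gcongr
          exact hb Y hY.le
      _ = ENNReal.ofReal (1 / n) * (C + ENNReal.ofReal Real.pi) := by
          rw [mul_add, ← ENNReal.ofReal_mul (by positivity), ← ENNReal.ofReal_mul (by positivity)]
          congr 2
          field_simp
  have hlim : Tendsto (fun n : ℕ => ENNReal.ofReal (1 / n) * (C + ENNReal.ofReal Real.pi)) atTop
      (𝓝 (ENNReal.ofReal 0 * (C + ENNReal.ofReal Real.pi))) := by
    refine ENNReal.Tendsto.mul_const ?_ (Or.inr ?_)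
    · exact (ENNReal.continuous_ofReal.tendsto 0).comp tendsto_one_div_atTop_nhds_zero_nat
    · exact (ENNReal.add_lt_top.2 ⟨hC, by simp⟩).ne
  have h0 := ge_of_tendsto hlim (eventually_atTop.2 ⟨1, fun n hn => hsmall n hn⟩)
  simpa using h0

end DeBranges

/-! ### The Poisson formula and norm bounds in `H_2`. -/

namespace DeBranges

/-- The Poisson kernel of the upper half-plane. -/
noncomputable def poissonKernel (w : ℂ) (t : ℝ) : ℝ :=
  w.im / Real.pi * (1 / ((t - w.re) ^ 2 + w.im ^ 2))

theorem poissonKernel_nonneg {w : ℂ} (hw : 0 < w.im) (t : ℝ) : 0 ≤ poissonKernel w t := by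
  unfold poissonKernel
  have := Real.pi_pos
  positivity

@[fun_prop] theorem measurable_poissonKernel (w : ℂ) : Measurable (poissonKernel w) := by
  unfold poissonKernel
  fun_prop

theorem poissonKernel_le {w : ℂ} (hw : 0 < w.im) (t : ℝ) :
    poissonKernel w t ≤ 1 / (Real.pi * w.im) := by
  have hp := Real.pi_pos
  have h1 : 1 / ((t - w.re) ^ 2 + w.im ^ 2) ≤ 1 / w.im ^ 2 :=
    one_div_le_one_div_of_le (by positivity) (by nlinarith [sq_nonneg (t - w.re)])
  calc poissonKernel w t ≤ w.im / Real.pi * (1 / w.im ^ 2) := by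
        unfold poissonKernel
        gcongr
    _ = 1 / (Real.pi * w.im) := by field_simp

theorem lintegral_poissonKernel {w : ℂ} (hw : 0 < w.im) :
    ∫⁻ t : ℝ, ENNReal.ofReal (poissonKernel w t) = 1 := by
  have hp := Real.pi_pos
  have h : ∀ t : ℝ, ENNReal.ofReal (poissonKernel w t) = ENNReal.ofReal (w.im / Real.pi) *
      ENNReal.ofReal (1 / ((t - w.re) ^ 2 + w.im ^ 2)) := fun t =>
    ENNReal.ofReal_mul (by positivity)
  simp_rw [h]
  rw [lintegral_const_mul _ (by fun_prop), lintegral_ofReal_inv_sq_add_sq _ hw,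
    ← ENNReal.ofReal_mul (by positivity)]
  rw [show w.im / Real.pi * (Real.pi / w.im) = 1 by field_simp, ENNReal.ofReal_one]

theorem integrable_poissonKernel {w : ℂ} (hw : 0 < w.im) : Integrable (poissonKernel w) := by
  refine ⟨(measurable_poissonKernel w).aestronglyMeasurable, ?_⟩
  rw [hasFiniteIntegral_iff_ofReal (Eventually.of_forall (poissonKernel_nonneg hw)),
    lintegral_poissonKernel hw]
  exact ENNReal.one_lt_top

theorem integral_poissonKernel {w : ℂ} (hw : 0 < w.im) : ∫ t, poissonKernel w t = 1 := by
  rw [integral_eq_lintegral_of_nonneg_ae (Eventually.of_forall (poissonKernel_nonneg hw))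
    (measurable_poissonKernel w).aestronglyMeasurable, lintegral_poissonKernel hw]
  simp

section
variable {F : ℂ → ℂ} (hc : ContinuousOn F {z : ℂ | 0 ≤ z.im})
  (hd : DifferentiableOn ℂ F {z : ℂ | 0 < z.im}) {C : ℝ≥0∞} (hC : C < ⊤)
  (hb : ∀ y : ℝ, 0 ≤ y → ∫⁻ t : ℝ, ‖F ((t : ℂ) + (y : ℂ) * I)‖ₑ ^ 2 ≤ C)
include hc hd hC hb

/-- The Poisson formula for `H_2`. -/
theorem integral_poissonKernel_mul {w : ℂ} (hw : 0 < w.im) :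
    Integrable (fun t : ℝ => (poissonKernel w t : ℂ) * F t) ∧
      ∫ t : ℝ, (poissonKernel w t : ℂ) * F t = F w := by
  have hopen : {z : ℂ | 0 < z.im} ∈ 𝓝 w :=
    (isOpen_lt continuous_const continuous_im).mem_nhds hw
  have hclosed : {z : ℂ | 0 ≤ z.im} ∈ 𝓝 w := mem_of_superset hopen fun z (hz : 0 < z.im) => hz.le
  have hdw : DifferentiableAt ℂ F w := hd.differentiableAt hopen
  have hne : ∀ z : ℂ, 0 ≤ z.im → z - conj w ≠ 0 := by
    intro z hz h
    have := congrArg im h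
    simp at this
    linarith
  have hnorm : ∀ t y : ℝ, 0 ≤ y → (t - w.re) ^ 2 + w.im ^ 2 ≤
      ‖((t : ℂ) + (y : ℂ) * I) - conj w‖ ^ 2 := by
    intro t y hy
    rw [norm_add_mul_I_sub_sq w.re t y (conj w) (conj_re w), conj_im]
    have : w.im ^ 2 ≤ (y - -w.im) ^ 2 := by
      apply pow_le_pow_left₀ hw.le
      linarith
    linarith
  -- The difference quotient removes the pole at `w`, and `conj w` lies in the lower half-plane. The
  -- function `(F z - F w)/(z - conj w)` is bounded in `L²` on horizontal lines, so the preceding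
  -- vanishing theorem applies.
  have key : Integrable (fun t : ℝ => dslope F w t / (t - conj w)) ∧
      ∫ t : ℝ, dslope F w t / (t - conj w) = 0 := by
    refine integral_eq_zero_of_norm_sub_mul_le
      (G := fun z => dslope F w z / (z - conj w)) (F := fun z => (F z - F w) / (z - conj w))
      (C := ENNReal.ofReal (2 / w.im ^ 2) * C + ENNReal.ofReal (2 * ‖F w‖ ^ 2) *
        ENNReal.ofReal (Real.pi / w.im)) ?_ ?_ ?_ ?_ w ?_
    · exact ((continuousOn_dslope hclosed).2 ⟨hc, hdw⟩).div (by fun_prop) fun z hz => hne z hz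
    · exact ((Complex.differentiableOn_dslope hopen).2 hd).div (by fun_prop)
        fun z hz => hne z (le_of_lt hz)
    · exact ENNReal.add_lt_top.2 ⟨ENNReal.mul_lt_top (by simp) hC, ENNReal.mul_lt_top ENNReal.ofReal_lt_top
        (by simp)⟩
    · intro y hy
      rw [← lintegral_ofReal_inv_sq_add_sq w.re hw, ← lintegral_const_mul _ (by fun_prop)]
      refine le_trans ?_ (add_le_add_left (mul_le_mul_right (hb y hy) _) _)
      rw [← lintegral_const_mul' _ _ (by simp), ← lintegral_add_right _ (by fun_prop)]
      refine lintegral_mono fun t => ?_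
      rw [← ofReal_norm, ← ofReal_norm, ← ENNReal.ofReal_pow (norm_nonneg _),
        ← ENNReal.ofReal_pow (norm_nonneg _), ← ENNReal.ofReal_mul (by positivity),
        ← ENNReal.ofReal_mul (by positivity), ← ENNReal.ofReal_add (by positivity) (by positivity)]
      refine ENNReal.ofReal_le_ofReal ?_
      have hn := hnorm t y hy
      set z := (t : ℂ) + (y : ℂ) * I
      have hq : 0 < (t - w.re) ^ 2 + w.im ^ 2 := by positivity
      have hv : w.im ^ 2 ≤ (t - w.re) ^ 2 + w.im ^ 2 := by nlinarith [sq_nonneg (t - w.re)]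
      rw [norm_div, div_pow]
      calc ‖F z - F w‖ ^ 2 / ‖z - conj w‖ ^ 2
          ≤ (2 * ‖F z‖ ^ 2 + 2 * ‖F w‖ ^ 2) / ((t - w.re) ^ 2 + w.im ^ 2) := by
            gcongr
            nlinarith [norm_sub_le (F z) (F w), sq_nonneg (‖F z‖ - ‖F w‖), norm_nonneg (F z - F w)]
        _ = 2 * ‖F z‖ ^ 2 / ((t - w.re) ^ 2 + w.im ^ 2) +
            2 * ‖F w‖ ^ 2 * (1 / ((t - w.re) ^ 2 + w.im ^ 2)) := by ring
        _ ≤ 2 * ‖F z‖ ^ 2 / w.im ^ 2 + 2 * ‖F w‖ ^ 2 * (1 / ((t - w.re) ^ 2 + w.im ^ 2)) := by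
            gcongr
        _ = _ := by ring
    · intro z hz
      rw [norm_div, norm_div, ← mul_div_assoc, ← norm_mul, ← smul_eq_mul, sub_smul_dslope]
  obtain ⟨hGi, hG0⟩ := key
  -- The kernel is `(Im w/π) / ((t - w)(t - conj w))`; subtracting `F w` from `F t` leaves the
  -- function whose integral was just shown to vanish.
  have hK : ∀ t : ℝ, (poissonKernel w t : ℂ) * F t =
      ((w.im / Real.pi : ℝ) : ℂ) * (dslope F w t / (t - conj w)) +
        (poissonKernel w t : ℂ) * F w := by
    intro t
    have htw : (t : ℂ) ≠ w := by
      intro h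
      have := congrArg im h
      simp at this
      linarith
    have h1 : (t : ℂ) - w ≠ 0 := sub_ne_zero.2 htw
    have h2 := hne t (by simp)
    have h3 : (((t - w.re) ^ 2 + w.im ^ 2 : ℝ) : ℂ) = (t - w) * (t - conj w) := by
      apply Complex.ext <;> simp [pow_two] <;> ring
    rw [dslope_of_ne _ htw, slope_def_field, poissonKernel, ofReal_mul, ofReal_div 1, h3]
    push_cast
    field_simp
    ring
  have hKi : Integrable fun t : ℝ => (poissonKernel w t : ℂ) :=
    (integrable_poissonKernel hw).ofReal
  simp_rw [hK]
  refine ⟨(hGi.const_mul _).add (hKi.mul_const _), ?_⟩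
  have hsum := integral_add (hGi.const_mul ((w.im / Real.pi : ℝ) : ℂ)) (hKi.mul_const (F w))
  rw [integral_const_mul, hG0, integral_mul_const, integral_complex_ofReal,
    integral_poissonKernel hw, ofReal_one, mul_zero, zero_add, one_mul] at hsum
  exact hsum

/-- The square of the modulus of a function in `H_2` is dominated by its Poisson integral. -/
theorem enorm_sq_le_lintegral_poissonKernel {w : ℂ} (hw : 0 < w.im) :
    ‖F w‖ₑ ^ 2 ≤ ∫⁻ t : ℝ, ENNReal.ofReal (poissonKernel w t) * ‖F t‖ₑ ^ 2 := by
  obtain ⟨hi, he⟩ := integral_poissonKernel_mul hc hd hC hb hw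
  have hFc : Continuous fun t : ℝ => F t := by simpa using continuous_horizontal hc le_rfl
  have hF2 : Integrable fun t : ℝ => ‖F t‖ ^ 2 := by
    refine ⟨(hFc.norm.pow 2).aestronglyMeasurable, ?_⟩
    rw [hasFiniteIntegral_iff_ofReal (Eventually.of_forall fun t => by positivity)]
    refine lt_of_le_of_lt ?_ hC
    simpa [ENNReal.ofReal_pow, ofReal_norm] using hb 0 le_rfl
  have hKF2 : Integrable fun t : ℝ => poissonKernel w t * ‖F t‖ ^ 2 := by
    refine hF2.bdd_mul (c := 1 / (Real.pi * w.im))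
      (measurable_poissonKernel w).aestronglyMeasurable (Eventually.of_forall fun t => ?_)
    rw [Real.norm_of_nonneg (poissonKernel_nonneg hw t)]
    exact poissonKernel_le hw t
  have h1 : ‖F w‖ ≤ ∫ t : ℝ, poissonKernel w t * ‖F t‖ := by
    rw [← he]
    refine (norm_integral_le_integral_norm _).trans (le_of_eq ?_)
    congr 1
    funext t
    rw [norm_mul, norm_real, Real.norm_of_nonneg (poissonKernel_nonneg hw t)]
  have hKF : Integrable fun t : ℝ => poissonKernel w t * ‖F t‖ := by
    refine hi.norm.congr (Eventually.of_forall fun t => ?_)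
    simp only [norm_mul, norm_real, Real.norm_of_nonneg (poissonKernel_nonneg hw t)]
  -- Jensen's inequality for the probability density `poissonKernel w`, obtained by integrating `2ab
  -- ≤ a² + b²`.
  have h2 : 2 * ‖F w‖ * ∫ t : ℝ, poissonKernel w t * ‖F t‖ ≤
      ‖F w‖ ^ 2 + ∫ t : ℝ, poissonKernel w t * ‖F t‖ ^ 2 := by
    calc 2 * ‖F w‖ * ∫ t : ℝ, poissonKernel w t * ‖F t‖
        = ∫ t : ℝ, 2 * ‖F w‖ * (poissonKernel w t * ‖F t‖) := by rw [integral_const_mul]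
      _ ≤ ∫ t : ℝ, (poissonKernel w t * ‖F w‖ ^ 2 + poissonKernel w t * ‖F t‖ ^ 2) := by
        refine integral_mono (hKF.const_mul _)
          (((integrable_poissonKernel hw).mul_const _).add hKF2) fun t => ?_
        nlinarith [mul_nonneg (poissonKernel_nonneg hw t) (sq_nonneg (‖F w‖ - ‖F t‖))]
      _ = ‖F w‖ ^ 2 + ∫ t : ℝ, poissonKernel w t * ‖F t‖ ^ 2 := by
        rw [integral_add ((integrable_poissonKernel hw).mul_const _) hKF2, integral_mul_const,
          integral_poissonKernel hw, one_mul]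
  have h3 : ‖F w‖ ^ 2 ≤ ∫ t : ℝ, poissonKernel w t * ‖F t‖ ^ 2 := by
    nlinarith [norm_nonneg (F w)]
  have h4 := ENNReal.ofReal_le_ofReal h3
  rw [ENNReal.ofReal_pow (norm_nonneg _), ofReal_norm,
    ofReal_integral_eq_lintegral_ofReal hKF2 (Eventually.of_forall fun t =>
      mul_nonneg (poissonKernel_nonneg hw t) (by positivity))] at h4
  refine h4.trans (le_of_eq ?_)
  congr 1
  funext t
  rw [ENNReal.ofReal_mul (poissonKernel_nonneg hw t), ENNReal.ofReal_pow (norm_nonneg _),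
    ofReal_norm]

theorem enorm_sq_le_mul_lintegral {w : ℂ} (hw : 0 < w.im) :
    ‖F w‖ₑ ^ 2 ≤ ENNReal.ofReal (1 / (Real.pi * w.im)) * ∫⁻ t : ℝ, ‖F t‖ₑ ^ 2 := by
  refine (enorm_sq_le_lintegral_poissonKernel hc hd hC hb hw).trans ?_
  rw [← lintegral_const_mul' _ _ (by simp)]
  refine lintegral_mono fun t => ?_
  gcongr
  exact poissonKernel_le hw t

/-- The Poisson kernel is symmetric in `x` and `t`, so Tonelli's theorem integrates out `x` with
total mass one. This replaces an unspecified Hardy bound by the norm on the real line. -/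
theorem lintegral_horizontal_le {y : ℝ} (hy : 0 < y) :
    ∫⁻ x : ℝ, ‖F ((x : ℂ) + (y : ℂ) * I)‖ₑ ^ 2 ≤ ∫⁻ t : ℝ, ‖F t‖ₑ ^ 2 := by
  have hFc : Continuous fun t : ℝ => F t := by simpa using continuous_horizontal hc le_rfl
  have hsymm : ∀ x t : ℝ, poissonKernel ((x : ℂ) + (y : ℂ) * I) t =
      poissonKernel ((t : ℂ) + (y : ℂ) * I) x := by
    intro x t
    simp only [poissonKernel, add_im, ofReal_im, mul_im, ofReal_re, I_im, mul_one, I_re, mul_zero,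
      add_zero, zero_add, add_re, mul_re, sub_self]
    ring
  calc ∫⁻ x : ℝ, ‖F ((x : ℂ) + (y : ℂ) * I)‖ₑ ^ 2
      ≤ ∫⁻ x : ℝ, ∫⁻ t : ℝ, ENNReal.ofReal (poissonKernel ((x : ℂ) + (y : ℂ) * I) t) *
          ‖F t‖ₑ ^ 2 := lintegral_mono fun x =>
        enorm_sq_le_lintegral_poissonKernel hc hd hC hb (by simpa using hy)
    _ = ∫⁻ t : ℝ, ∫⁻ x : ℝ, ENNReal.ofReal (poissonKernel ((x : ℂ) + (y : ℂ) * I) t) *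
          ‖F t‖ₑ ^ 2 := by
        refine lintegral_lintegral_swap (Measurable.aemeasurable ?_)
        refine Measurable.mul ?_ ((hFc.enorm.measurable.comp measurable_snd).pow_const 2)
        unfold poissonKernel
        fun_prop
    _ = ∫⁻ t : ℝ, ‖F t‖ₑ ^ 2 := by
        refine lintegral_congr fun t => ?_
        simp_rw [hsymm _ t]
        rw [lintegral_mul_const _ (by fun_prop), lintegral_poissonKernel (by simpa using hy),
          one_mul]

end

end DeBranges

/-! ### Bounded point evaluations and completeness of the de Branges space. -/

namespace DeBranges

theorem differentiable_sharp {f : ℂ → ℂ} (hf : Differentiable ℂ f) : Differentiable ℂ (sharp f) := by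
  intro z
  have h := (hf (conj z)).conj_conj
  rw [conj_conj] at h
  exact h

theorem sharp_sharp (f : ℂ → ℂ) : sharp (sharp f) = f := by
  funext z
  simp [sharp]

theorem sharp_ofReal (f : ℂ → ℂ) (t : ℝ) : sharp f t = conj (f t) := by simp [sharp]

theorem norm_sharp_le (e : HermiteBiehler) {z : ℂ} (hz : 0 ≤ z.im) :
    ‖sharp e.toFun z‖ ≤ ‖e.toFun z‖ := by
  rcases hz.eq_or_lt with h | h
  · have : conj z = z := conj_eq_iff_im.2 h.symm
    rw [sharp, norm_conj, this]
  · rw [sharp, norm_conj]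
    exact (e.norm_conj_lt z h).le

theorem ne_zero_of_im_nonneg {e : HermiteBiehler} (he : ∀ x : ℝ, e.toFun x ≠ 0) {z : ℂ}
    (hz : 0 ≤ z.im) : e.toFun z ≠ 0 := by
  rcases hz.eq_or_lt with h | h
  · have : z = (z.re : ℂ) := Complex.ext rfl (by simp [← h])
    rw [this]
    exact he _
  · exact ne_zero_of_im_pos e h

theorem continuousOn_div {e : HermiteBiehler} (he : ∀ x : ℝ, e.toFun x ≠ 0) {f : ℂ → ℂ}
    (hf : Differentiable ℂ f) : ContinuousOn (fun z => f z / e.toFun z) {z : ℂ | 0 ≤ z.im} :=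
  hf.continuous.continuousOn.div e.entire.continuous.continuousOn
    fun _ hz => ne_zero_of_im_nonneg he hz

theorem differentiableOn_div (e : HermiteBiehler) {f : ℂ → ℂ} (hf : Differentiable ℂ f) :
    DifferentiableOn ℂ (fun z => f z / e.toFun z) {z : ℂ | 0 < z.im} :=
  hf.differentiableOn.div e.entire.differentiableOn fun _ hz => ne_zero_of_im_pos e hz

theorem sharp_mem_functions {e : HermiteBiehler} {f : ℂ → ℂ} (hf : f ∈ functions e) :
    sharp f ∈ functions e :=
  ⟨differentiable_sharp hf.1, hf.2.2, by rw [sharp_sharp]; exact hf.2.1⟩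

variable {e : HermiteBiehler}

/-- The conjugation `f ↦ f^#` of the de Branges space. -/
def Space.sharp (f : Space e) : Space e := Space.mk (DeBranges.sharp f) (sharp_mem_functions f.mem)

theorem Space.sharp_apply (f : Space e) (z : ℂ) : f.sharp z = conj (f (conj z)) := rfl

theorem inner_eq_integral (g f : Space e) :
    inner ℂ g f = ∫ x : ℝ, conj (g x) * f x / ((‖e.toFun x‖ : ℂ) ^ 2) := rfl

theorem ofReal_norm_sq (f : Space e) :
    ENNReal.ofReal (‖f‖ ^ 2) = ∫⁻ t : ℝ, ‖f t / e.toFun t‖ₑ ^ 2 := by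
  have h1 : ‖f‖ ^ 2 = ∫ t : ℝ, ‖f t / e.toFun t‖ ^ 2 := by
    have h2 := inner_self_eq_norm_sq_to_K (𝕜 := ℂ) f
    rw [inner_eq_integral] at h2
    have h3 : (fun x : ℝ => conj (f x) * f x / ((‖e.toFun x‖ : ℂ) ^ 2)) =
        fun x : ℝ => ((‖f x / e.toFun x‖ ^ 2 : ℝ) : ℂ) := by
      funext x
      rw [Complex.conj_mul', norm_div]
      push_cast
      rw [div_pow]
    rw [h3, integral_complex_ofReal] at h2
    have h4 : ((‖f‖ ^ 2 : ℝ) : ℂ) = ((∫ t : ℝ, ‖f t / e.toFun t‖ ^ 2 : ℝ) : ℂ) := by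
      rw [ofReal_pow]
      exact h2.symm
    exact ofReal_injective h4
  have hint : Integrable fun t : ℝ => ‖f t / e.toFun t‖ ^ 2 :=
    (memLp_two_iff_integrable_sq_norm (memLp_div f).1).1 (memLp_div f)
  rw [h1, ofReal_integral_eq_lintegral_ofReal hint (Eventually.of_forall fun t => by positivity)]
  refine lintegral_congr fun t => ?_
  rw [ENNReal.ofReal_pow (norm_nonneg _), ofReal_norm]

theorem Space.norm_sharp (f : Space e) : ‖f.sharp‖ = ‖f‖ := by
  have h : ENNReal.ofReal (‖f.sharp‖ ^ 2) = ENNReal.ofReal (‖f‖ ^ 2) := by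
    rw [ofReal_norm_sq, ofReal_norm_sq]
    refine lintegral_congr fun t => ?_
    rw [Space.sharp_apply, conj_ofReal, ← ofReal_norm, ← ofReal_norm, norm_div, norm_div,
      norm_conj]
  rw [ENNReal.ofReal_eq_ofReal_iff (by positivity) (by positivity)] at h
  exact (pow_left_inj₀ (norm_nonneg _) (norm_nonneg _) two_ne_zero).1 h

theorem exists_lintegral_horizontal_le (f : Space e) : ∃ C : ℝ≥0∞, C < ⊤ ∧ ∀ y : ℝ, 0 ≤ y →
    ∫⁻ t : ℝ, ‖f ((t : ℂ) + (y : ℂ) * I) / e.toFun ((t : ℂ) + (y : ℂ) * I)‖ₑ ^ 2 ≤ C := by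
  obtain ⟨C, hC, hb⟩ := f.mem.2.1.bound
  refine ⟨max C (ENNReal.ofReal (‖f‖ ^ 2)), max_lt hC ENNReal.ofReal_lt_top, fun y hy => ?_⟩
  rcases hy.eq_or_lt with h | h
  · refine le_trans (le_of_eq ?_) (le_max_right _ _)
    rw [ofReal_norm_sq]
    simp [← h]
  · exact (hb y h).trans (le_max_left _ _)

theorem lintegral_horizontal_div_le (he : ∀ x : ℝ, e.toFun x ≠ 0) (f : Space e) {y : ℝ}
    (hy : 0 ≤ y) : ∫⁻ t : ℝ, ‖f ((t : ℂ) + (y : ℂ) * I) / e.toFun ((t : ℂ) + (y : ℂ) * I)‖ₑ ^ 2 ≤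
      ENNReal.ofReal (‖f‖ ^ 2) := by
  rw [ofReal_norm_sq]
  rcases hy.eq_or_lt with h | h
  · simp [← h]
  · obtain ⟨C, hC, hb⟩ := exists_lintegral_horizontal_le f
    exact lintegral_horizontal_le (F := fun z => f z / e.toFun z) (continuousOn_div he f.mem.1)
      (differentiableOn_div e f.mem.1) hC hb h

theorem norm_sq_mul_im_le_of_pos (he : ∀ x : ℝ, e.toFun x ≠ 0) (f : Space e) {w : ℂ}
    (hw : 0 < w.im) : ‖f w‖ ^ 2 * w.im ≤ ‖e.toFun w‖ ^ 2 * ‖f‖ ^ 2 := by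
  obtain ⟨C, hC, hb⟩ := exists_lintegral_horizontal_le f
  have h := enorm_sq_le_mul_lintegral (F := fun z => f z / e.toFun z) (continuousOn_div he f.mem.1)
      (differentiableOn_div e f.mem.1) hC hb hw
  have hp := Real.pi_gt_three
  rw [← ofReal_norm_sq, ← ENNReal.ofReal_mul (by positivity), ← ofReal_norm,
    ← ENNReal.ofReal_pow (norm_nonneg _), ENNReal.ofReal_le_ofReal_iff (by positivity), norm_div,
    div_pow] at h
  have he0 : 0 < ‖e.toFun w‖ := norm_pos_iff.2 (ne_zero_of_im_pos e hw)
  rw [div_le_iff₀ (by positivity), one_div_mul_eq_div, div_mul_eq_mul_div,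
    le_div_iff₀ (by positivity)] at h
  nlinarith [mul_nonneg (sq_nonneg ‖f w‖) hw.le]

theorem norm_sq_mul_abs_im_le (he : ∀ x : ℝ, e.toFun x ≠ 0) (f : Space e) (w : ℂ) :
    ‖f w‖ ^ 2 * |w.im| ≤ (‖e.toFun w‖ ^ 2 + ‖e.toFun (conj w)‖ ^ 2) * ‖f‖ ^ 2 := by
  rcases lt_trichotomy w.im 0 with h | h | h
  · have h1 := norm_sq_mul_im_le_of_pos he f.sharp (w := conj w) (by simpa using h)
    rw [Space.sharp_apply, conj_conj, norm_conj, Space.norm_sharp, conj_im] at h1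
    rw [abs_of_neg h]
    nlinarith [mul_nonneg (sq_nonneg ‖e.toFun w‖) (sq_nonneg ‖f‖)]
  · rw [h, abs_zero, mul_zero]
    positivity
  · rw [abs_of_pos h]
    nlinarith [norm_sq_mul_im_le_of_pos he f h,
      mul_nonneg (sq_nonneg ‖e.toFun (conj w)‖) (sq_nonneg ‖f‖)]

/-- Point evaluations of `B(e)` are bounded, locally uniformly. -/
theorem exists_norm_apply_le (he : ∀ x : ℝ, e.toFun x ≠ 0) {R : ℝ} (hR : 0 < R) :
    ∃ C : ℝ, 0 ≤ C ∧ ∀ (f : Space e) (z : ℂ), ‖z‖ ≤ R → ‖f z‖ ≤ C * ‖f‖ := by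
  have hcont : Continuous fun w : ℂ => ‖e.toFun w‖ ^ 2 + ‖e.toFun (conj w)‖ ^ 2 := by
    have := e.entire.continuous
    fun_prop
  obtain ⟨M, hM⟩ := (isCompact_sphere (0 : ℂ) (2 * R)).exists_bound_of_continuousOn
    hcont.continuousOn
  set N := max M 0
  have hN0 : 0 ≤ N := le_max_right _ _
  refine ⟨4 * R * √(2 * R * N) / (3 * R ^ 2), by positivity, fun f z hz => ?_⟩
  -- The bound on `f w` degenerates like `|Im w|^(-1/2)` at the real axis. On the circle of radius
  -- `2R` the factor `z² - (2R)²` has modulus `4R |Im z|`, which cancels this; on the disc of radius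
  -- `R` it is at least `3R²`, so the maximum principle transfers the bound inside.
  have hmax := Complex.norm_le_of_forall_mem_frontier_norm_le
    (U := Metric.ball (0 : ℂ) (2 * R)) (f := fun z => (z ^ 2 - (2 * R) ^ 2) * f z)
    (C := 4 * R * (√(2 * R * N) * ‖f‖)) Metric.isBounded_ball
    (Differentiable.diffContOnCl (by have := f.mem.1; fun_prop)) ?_
    (z := z) (subset_closure (by simpa using by linarith))
  · have h1 : 3 * R ^ 2 ≤ ‖z ^ 2 - (2 * R : ℂ) ^ 2‖ := by
      have h2 : ‖(2 * R : ℂ) ^ 2‖ = 4 * R ^ 2 := by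
        rw [norm_pow, norm_mul, norm_real, Real.norm_of_nonneg hR.le]
        norm_num
        ring
      have h3 := norm_sub_norm_le ((2 * R : ℂ) ^ 2) (z ^ 2)
      rw [h2, norm_pow, norm_sub_rev] at h3
      nlinarith [pow_le_pow_left₀ (norm_nonneg z) hz 2]
    rw [norm_mul] at hmax
    rw [div_mul_eq_mul_div, le_div_iff₀ (by positivity)]
    nlinarith [norm_nonneg (f z)]
  · intro w hw
    rw [frontier_ball _ (by positivity)] at hw
    have hnw : ‖w‖ = 2 * R := by simpa using hw
    have h1 : ‖w ^ 2 - (2 * R : ℂ) ^ 2‖ = 4 * R * |w.im| := by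
      have h2 : (2 * R : ℂ) ^ 2 = w * conj w := by
        rw [mul_conj, normSq_eq_norm_sq, hnw]
        push_cast
        ring
      rw [h2, pow_two, ← mul_sub, norm_mul, hnw, sub_conj, norm_mul, norm_I, norm_real, mul_one,
        Real.norm_eq_abs, abs_mul, abs_two]
      ring
    rw [norm_mul, h1, mul_assoc]
    refine mul_le_mul_of_nonneg_left ?_ (by positivity)
    have him : |w.im| ≤ 2 * R := hnw ▸ abs_im_le_norm w
    refine abs_le_of_sq_le_sq' ?_ (by positivity) |>.2
    rw [mul_pow, mul_pow, Real.sq_sqrt (by positivity)]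
    have h4 := norm_sq_mul_abs_im_le he f w
    have h5 : ‖e.toFun w‖ ^ 2 + ‖e.toFun (conj w)‖ ^ 2 ≤ N := by
      refine le_trans ?_ ((hM w hw).trans (le_max_left _ _))
      exact le_abs_self _
    calc |w.im| ^ 2 * ‖f w‖ ^ 2 = |w.im| * (‖f w‖ ^ 2 * |w.im|) := by ring
      _ ≤ (2 * R) * (N * ‖f‖ ^ 2) := by
        refine mul_le_mul him (h4.trans ?_) (by positivity) (by positivity)
        gcongr
      _ = 2 * R * N * ‖f‖ ^ 2 := by ring

/-- Point evaluation, as a bounded functional. -/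
noncomputable def evalCLM (he : ∀ x : ℝ, e.toFun x ≠ 0) (z : ℂ) : Space e →L[ℂ] ℂ :=
  LinearMap.mkContinuousOfExistsBound
    { toFun := fun f => f z
      map_add' := fun _ _ => rfl
      map_smul' := fun _ _ => rfl }
    (by
      obtain ⟨C, -, hC⟩ := exists_norm_apply_le he (R := ‖z‖ + 1) (by positivity)
      exact ⟨C, fun f => hC f z (by linarith)⟩)

theorem evalCLM_apply (he : ∀ x : ℝ, e.toFun x ≠ 0) (z : ℂ) (f : Space e) :
    evalCLM he z f = f z := rfl

theorem tendsto_apply (he : ∀ x : ℝ, e.toFun x ≠ 0) {u : ℕ → Space e} {f : Space e}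
    (h : Tendsto u atTop (𝓝 f)) (z : ℂ) : Tendsto (fun n => u n z) atTop (𝓝 (f z)) :=
  ((evalCLM he z).continuous.tendsto f).comp h

@[simp] theorem sub_apply (f g : Space e) (z : ℂ) : (f - g) z = f z - g z := rfl

/-- Fatou's lemma. It serves twice in the proof of completeness: to put the pointwise limit in the
space, and to pass from pointwise to norm convergence. -/
theorem lintegral_div_le_of_tendsto (he : ∀ x : ℝ, e.toFun x ≠ 0) {u : ℕ → Space e} {F : ℂ → ℂ}
    {B : ℝ} (hB : ∀ n, ‖u n‖ ≤ B) (hF : ∀ z, Tendsto (fun n => u n z) atTop (𝓝 (F z))) {y : ℝ}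
    (hy : 0 ≤ y) : ∫⁻ t : ℝ, ‖F ((t : ℂ) + (y : ℂ) * I) / e.toFun ((t : ℂ) + (y : ℂ) * I)‖ₑ ^ 2 ≤
      ENNReal.ofReal (B ^ 2) := by
  have hlim : ∀ t : ℝ, ‖F ((t : ℂ) + (y : ℂ) * I) / e.toFun ((t : ℂ) + (y : ℂ) * I)‖ₑ ^ 2 =
      liminf (fun n => ‖u n ((t : ℂ) + (y : ℂ) * I) / e.toFun ((t : ℂ) + (y : ℂ) * I)‖ₑ ^ 2)
        atTop := fun t => by
    have h1 := (hF ((t : ℂ) + (y : ℂ) * I)).div_const (e.toFun ((t : ℂ) + (y : ℂ) * I))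
    have h2 := (((ENNReal.continuous_pow 2).comp continuous_enorm).tendsto _).comp h1
    exact h2.liminf_eq.symm
  simp_rw [hlim]
  refine (lintegral_liminf_le fun n => ?_).trans ?_
  · exact ((continuous_horizontal (continuousOn_div he (u n).mem.1) hy).enorm.measurable).pow_const 2
  · refine (liminf_le_liminf (Eventually.of_forall fun n =>
      (lintegral_horizontal_div_le he (u n) hy).trans
        (ENNReal.ofReal_le_ofReal (pow_le_pow_left₀ (norm_nonneg _) (hB n) 2)))).trans ?_
    simp

theorem completeSpace (he : ∀ x : ℝ, e.toFun x ≠ 0) : CompleteSpace (Space e) := by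
  refine Metric.complete_of_cauchySeq_tendsto fun u hu => ?_
  have hpt : ∀ z, CauchySeq fun n => u n z := fun z => hu.map (evalCLM he z).uniformContinuous
  choose F hF using fun z => cauchySeq_tendsto_of_complete (hpt z)
  have hunif : TendstoLocallyUniformlyOn (fun n => (u n : ℂ → ℂ)) F atTop univ := by
    refine (tendstoLocallyUniformlyOn_iff_forall_isCompact isOpen_univ).2 fun K _ hK => ?_
    refine UniformCauchySeqOn.tendstoUniformlyOn_of_tendsto ?_ fun z _ => hF z
    obtain ⟨R, hR⟩ := hK.isBounded.exists_norm_le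
    obtain ⟨C, hC0, hC⟩ := exists_norm_apply_le he (R := max R 1) (by positivity)
    refine Metric.uniformCauchySeqOn_iff.2 fun ε hε => ?_
    obtain ⟨N, hN⟩ := Metric.cauchySeq_iff.1 hu (ε / (C + 1)) (by positivity)
    refine ⟨N, fun m hm n hn z hz => ?_⟩
    have h1 := hN m hm n hn
    rw [dist_eq_norm, lt_div_iff₀ (by positivity)] at h1
    rw [dist_eq_norm, ← sub_apply]
    have h2 := hC (u m - u n) z ((hR z hz).trans (le_max_left _ _))
    nlinarith [norm_nonneg (u m - u n)]
  have hFd : Differentiable ℂ F := by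
    rw [← differentiableOn_univ]
    exact hunif.differentiableOn (Eventually.of_forall fun n => (u n).mem.1.differentiableOn)
      isOpen_univ
  obtain ⟨B, hB⟩ := hu.isBounded_range.exists_norm_le
  have hB' : ∀ n, ‖u n‖ ≤ B := fun n => hB _ (mem_range_self n)
  have hFs : ∀ z, Tendsto (fun n => (u n).sharp z) atTop (𝓝 (sharp F z)) := fun z =>
    (continuous_conj.tendsto _).comp (hF (conj z))
  have hmem : F ∈ functions e := by
    refine ⟨hFd, MemHardyTwo.of_bound (differentiableOn_div e hFd)
      (C := ENNReal.ofReal (B ^ 2)) ENNReal.ofReal_lt_top fun y hy =>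
        lintegral_div_le_of_tendsto he hB' hF hy.le,
      MemHardyTwo.of_bound (differentiableOn_div e (differentiable_sharp hFd))
      (C := ENNReal.ofReal (B ^ 2)) ENNReal.ofReal_lt_top fun y hy =>
        lintegral_div_le_of_tendsto he (fun n => ?_) hFs hy.le⟩
    rw [Space.norm_sharp]
    exact hB' n
  refine ⟨Space.mk F hmem, Metric.tendsto_atTop.2 fun ε hε => ?_⟩
  obtain ⟨N, hN⟩ := Metric.cauchySeq_iff.1 hu (ε / 2) (half_pos hε)
  refine ⟨N, fun n hn => ?_⟩
  rw [dist_eq_norm]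
  have h1 := lintegral_div_le_of_tendsto he (u := fun k => u n - u (k + N)) (B := ε / 2)
    (F := Space.toFun (u n - Space.mk F hmem))
    (fun k => by
      rw [← dist_eq_norm]
      exact (hN n hn (k + N) (Nat.le_add_left _ _)).le)
    (fun z => tendsto_const_nhds.sub ((tendsto_add_atTop_iff_nat N).2 (hF z))) le_rfl
  simp only [ofReal_zero, zero_mul, add_zero] at h1
  rw [← ofReal_norm_sq, ENNReal.ofReal_le_ofReal_iff (by positivity)] at h1
  have := (pow_le_pow_iff_left₀ (norm_nonneg _) (by positivity) two_ne_zero).1 h1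
  linarith

end DeBranges

/-! ### The functions `s_β`, division by `z - l`, and resolvents. -/

namespace DeBranges

variable {e : HermiteBiehler}

theorem s_eq (e : HermiteBiehler) (β : ℝ) (z : ℂ) : s e β z =
    I / 2 * exp (I * β) * e.toFun z + -(I / 2 * exp (-(I * β))) * sharp e.toFun z := by
  rw [s]
  ring

theorem differentiable_s (e : HermiteBiehler) (β : ℝ) : Differentiable ℂ (s e β) := by
  have h1 := e.entire
  have h2 := differentiable_sharp e.entire
  have : s e β = fun z => I / 2 * exp (I * β) * e.toFun z +
    -(I / 2 * exp (-(I * β))) * sharp e.toFun z := funext (s_eq e β)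
  rw [this]
  fun_prop

theorem conj_s_conj (e : HermiteBiehler) (β : ℝ) (z : ℂ) : conj (s e β (conj z)) = s e β z := by
  simp only [s, sharp, map_mul, map_sub, map_div₀, conj_I, conj_conj, ← exp_conj, map_neg,
    conj_ofReal, map_ofNat]
  ring_nf

theorem conj_s_ofReal (e : HermiteBiehler) (β t : ℝ) : conj (s e β t) = s e β t := by
  have := conj_s_conj e β t
  rwa [conj_ofReal] at this

theorem s_ne_zero_of_im_pos (e : HermiteBiehler) (β : ℝ) {z : ℂ} (hz : 0 < z.im) :
    s e β z ≠ 0 := by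
  intro h
  have h1 : exp (I * β) * e.toFun z = exp (-(I * β)) * sharp e.toFun z := by
    rw [s, mul_eq_zero, sub_eq_zero] at h
    exact h.resolve_left (by simp)
  have h2 := congrArg norm h1
  rw [norm_mul, norm_mul, mul_comm I, norm_exp_ofReal_mul_I, ← neg_mul, ← ofReal_neg,
    norm_exp_ofReal_mul_I, one_mul, one_mul, sharp, norm_conj] at h2
  exact absurd (e.norm_conj_lt z hz) (by rw [h2]; exact lt_irrefl _)

/-- The zeros of `s_β` are real. -/
theorem im_eq_zero_of_s_eq_zero {β : ℝ} {z : ℂ} (h : s e β z = 0) : z.im = 0 := by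
  by_contra hne
  rcases lt_or_gt_of_ne hne with h1 | h1
  · refine s_ne_zero_of_im_pos e β (z := conj z) (by simpa using h1) ?_
    rw [← conj_s_conj, conj_conj, h, map_zero]
  · exact s_ne_zero_of_im_pos e β h1 h

/-- All `s_β` lie in one two-dimensional space, in which changing `β` is a rotation. -/
theorem s_eq_cos_mul_add_sin_mul (e : HermiteBiehler) (β γ : ℝ) (z : ℂ) : s e β z =
    Real.cos (β - γ) * s e γ z + Real.sin (β - γ) * s e (γ + Real.pi / 2) z := by
  have h1 : exp (I * β) = exp (I * γ) * exp (I * (β - γ)) := by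
    rw [← exp_add]
    ring_nf
  have h2 : exp (-(I * β)) = exp (-(I * γ)) * exp (-(I * (β - γ))) := by
    rw [← exp_add]
    ring_nf
  have h3 : exp (I * (γ + Real.pi / 2)) = exp (I * γ) * I := by
    rw [mul_add, exp_add, mul_comm I (Real.pi / 2 : ℂ), exp_pi_div_two_mul_I]
  have h4 : exp (-(I * (γ + Real.pi / 2))) = exp (-(I * γ)) * (-I) := by
    rw [mul_add, neg_add, exp_add, mul_comm I (Real.pi / 2 : ℂ), ← neg_mul (Real.pi / 2 : ℂ),
      ← neg_div, exp_neg_pi_div_two_mul_I]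
  have h5 : exp (I * (β - γ)) = cos (β - γ) + sin (β - γ) * I := by
    rw [mul_comm, exp_mul_I]
  have h6 : exp (-(I * (β - γ))) = cos (β - γ) - sin (β - γ) * I := by
    rw [mul_comm, ← neg_mul, exp_mul_I, cos_neg, sin_neg]
    ring
  simp only [s]
  push_cast
  rw [h1, h2, h3, h4, h5, h6]
  ring

theorem toFun_eq_s (e : HermiteBiehler) (z : ℂ) :
    e.toFun z = -s e (Real.pi / 2) z - I * s e 0 z := by
  have h3 : exp (I * (Real.pi / 2)) = I := by
    rw [mul_comm I, exp_pi_div_two_mul_I]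
  have h4 : exp (-(I * (Real.pi / 2))) = -I := by
    rw [mul_comm I, ← neg_mul, ← neg_div, exp_neg_pi_div_two_mul_I]
  simp only [s]
  push_cast
  rw [h3, h4]
  simp
  linear_combination (e.toFun z) * I_mul_I

/-- Since `|e^#/e| ≤ 1` in the upper half-plane, the numerator over `e` is an `H_2` function plus a
bounded one. Dividing by `z - l` makes the bounded part square integrable on lines away from `l`,
and near `l` compactness suffices. -/
theorem memHardyTwo_div_of_sub_mul_eq (he : ∀ x : ℝ, e.toFun x ≠ 0) {p : ℂ → ℂ}
    (hp : Differentiable ℂ p) (f : Space e) {l a b : ℂ}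
    (h : ∀ z, (z - l) * p z = f z + (a * e.toFun z + b * sharp e.toFun z)) :
    MemHardyTwo fun z => p z / e.toFun z := by
  obtain ⟨M, hM⟩ : ∃ M : ℝ, ∀ z : ℂ, 0 ≤ z.im → ‖z - l‖ ≤ 1 → ‖p z / e.toFun z‖ ≤ M := by
    have hK : IsCompact (Metric.closedBall l 1 ∩ {z : ℂ | 0 ≤ z.im}) :=
      (isCompact_closedBall l 1).inter_right (isClosed_le continuous_const continuous_im)
    obtain ⟨M, hM⟩ := hK.exists_bound_of_continuousOn
      ((continuousOn_div he hp).mono inter_subset_right)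
    exact ⟨M, fun z hz hzw => hM z ⟨by simpa [dist_eq_norm] using hzw, hz⟩⟩
  set A := ‖a‖ + ‖b‖
  refine MemHardyTwo.of_bound (differentiableOn_div e hp)
    (C := ENNReal.ofReal 2 * ENNReal.ofReal (‖f‖ ^ 2) +
      ENNReal.ofReal (2 * M ^ 2 + 4 * A ^ 2) * ENNReal.ofReal (Real.pi / 1))
    (ENNReal.add_lt_top.2 ⟨ENNReal.mul_lt_top ENNReal.ofReal_lt_top ENNReal.ofReal_lt_top,
      ENNReal.mul_lt_top ENNReal.ofReal_lt_top ENNReal.ofReal_lt_top⟩) fun y hy => ?_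
  rw [← lintegral_ofReal_inv_sq_add_sq l.re one_pos, ← lintegral_const_mul _ (by fun_prop)]
  refine le_trans ?_ (add_le_add_left
    (mul_le_mul_right (lintegral_horizontal_div_le he f hy.le) _) _)
  rw [← lintegral_const_mul' _ _ (by simp), ← lintegral_add_right _ (by fun_prop)]
  refine lintegral_mono fun t => ?_
  rw [← ofReal_norm, ← ofReal_norm, ← ENNReal.ofReal_pow (norm_nonneg _),
    ← ENNReal.ofReal_pow (norm_nonneg _), ← ENNReal.ofReal_mul (by positivity),
    ← ENNReal.ofReal_mul (by positivity), ← ENNReal.ofReal_add (by positivity) (by positivity)]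
  refine ENNReal.ofReal_le_ofReal ?_
  have hz : 0 < ((t : ℂ) + (y : ℂ) * I).im := by simpa using hy
  have hn := norm_add_mul_I_sub_sq l.re t y l rfl
  set z := (t : ℂ) + (y : ℂ) * I
  have hu : 0 < (t - l.re) ^ 2 + 1 ^ 2 := by positivity
  rcases le_or_gt ‖z - l‖ 1 with h1 | h1
  · have h2 : (t - l.re) ^ 2 ≤ 1 := by nlinarith [norm_nonneg (z - l), sq_nonneg (y - l.im)]
    have h3 : M ^ 2 ≤ (2 * M ^ 2 + 4 * A ^ 2) * (1 / ((t - l.re) ^ 2 + 1 ^ 2)) := by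
      rw [mul_one_div, le_div_iff₀ hu]
      nlinarith [sq_nonneg M, sq_nonneg A]
    have h4 := pow_le_pow_left₀ (norm_nonneg _) (hM z hz.le h1) 2
    nlinarith [sq_nonneg ‖f z / e.toFun z‖]
  · have h0 : ‖z - l‖ * ‖p z / e.toFun z‖ ≤ ‖f z / e.toFun z‖ + A := by
      have he0 := ne_zero_of_im_pos e hz
      have hr : ‖sharp e.toFun z / e.toFun z‖ ≤ 1 := by
        rw [norm_div]
        exact div_le_one_of_le₀ (norm_sharp_le e hz.le) (norm_nonneg _)
      have h2 : (z - l) * (p z / e.toFun z) =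
          f z / e.toFun z + (a + b * (sharp e.toFun z / e.toFun z)) := by
        rw [← mul_div_assoc, h z]
        field_simp
      rw [← norm_mul, h2]
      refine (norm_add_le _ _).trans ?_
      refine add_le_add_right ((norm_add_le _ _).trans (add_le_add_right ?_ _)) _
      rw [norm_mul]
      exact mul_le_of_le_one_right (norm_nonneg _) hr
    have h2 : (t - l.re) ^ 2 + 1 ^ 2 ≤ 2 * ‖z - l‖ ^ 2 := by nlinarith [sq_nonneg (y - l.im)]
    have hA : 0 ≤ A := by positivity
    have h3 : ‖z - l‖ ^ 2 * ‖p z / e.toFun z‖ ^ 2 ≤ 2 * ‖f z / e.toFun z‖ ^ 2 + 2 * A ^ 2 := by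
      rw [← mul_pow]
      refine (pow_le_pow_left₀ (by positivity) h0 2).trans ?_
      nlinarith [sq_nonneg (‖f z / e.toFun z‖ - A)]
    have h5 : ‖p z / e.toFun z‖ ^ 2 ≤
        (2 * ‖f z / e.toFun z‖ ^ 2 + 2 * A ^ 2) / ‖z - l‖ ^ 2 := by
      rw [le_div_iff₀ (by positivity)]
      linarith
    have h6 : 2 * ‖f z / e.toFun z‖ ^ 2 / ‖z - l‖ ^ 2 ≤ 2 * ‖f z / e.toFun z‖ ^ 2 :=
      div_le_self (by positivity) (by nlinarith)
    have h7 : 2 * A ^ 2 / ‖z - l‖ ^ 2 ≤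
        (2 * M ^ 2 + 4 * A ^ 2) * (1 / ((t - l.re) ^ 2 + 1 ^ 2)) := by
      rw [mul_one_div, div_le_div_iff₀ (by positivity) hu]
      nlinarith [sq_nonneg M, sq_nonneg A, mul_le_mul_of_nonneg_left h2 (sq_nonneg A),
        mul_nonneg (sq_nonneg M) (sq_nonneg ‖z - l‖)]
    rw [add_div] at h5
    linarith

/-- Division of `f + a e + b e^#` by `z - l` stays in the space, if the quotient is entire. -/
theorem mem_functions_of_sub_mul_eq (he : ∀ x : ℝ, e.toFun x ≠ 0) {p : ℂ → ℂ}
    (hp : Differentiable ℂ p) (f : Space e) {l a b : ℂ}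
    (h : ∀ z, (z - l) * p z = f z + (a * e.toFun z + b * sharp e.toFun z)) :
    p ∈ functions e := by
  refine ⟨hp, memHardyTwo_div_of_sub_mul_eq he hp f h,
    memHardyTwo_div_of_sub_mul_eq he (differentiable_sharp hp) f.sharp
      (l := conj l) (a := conj b) (b := conj a) fun z => ?_⟩
  have := congrArg conj (h (conj z))
  simp only [map_mul, map_sub, map_add, conj_conj] at this
  simp only [sharp, Space.sharp_apply, this, conj_conj]
  ring

/-- The common source of resolvents (`c = f l / s_β(l)`), of eigenvectors (`f = 0`, `c = -1`) and of
preimages under multiplication by `z - l` (`c = 0`). -/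
theorem exists_sub_mul_eq (he : ∀ x : ℝ, e.toFun x ≠ 0) (β : ℝ) (f : Space e) (c l : ℂ)
    (h : f l = c * s e β l) : ∃ u : Space e, ∀ z, (z - l) * u z = f z - c * s e β z := by
  have hd : Differentiable ℂ fun z => f z - c * s e β z := by
    have h1 := f.mem.1
    have h2 := differentiable_s e β
    fun_prop
  have hq : ∀ z, (z - l) * dslope (fun z => f z - c * s e β z) l z = f z - c * s e β z := by
    intro z
    rw [← smul_eq_mul, sub_smul_dslope, h, sub_self, sub_zero]
  have hqd : Differentiable ℂ (dslope (fun z => f z - c * s e β z) l) := by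
    rw [← differentiableOn_univ] at hd ⊢
    exact (Complex.differentiableOn_dslope univ_mem).2 hd
  refine ⟨Space.mk _ (mem_functions_of_sub_mul_eq he hqd f
    (l := l) (a := -c * (I / 2 * exp (I * β))) (b := c * (I / 2 * exp (-(I * β))))
    fun z => ?_), hq⟩
  rw [hq, s_eq]
  ring

theorem ext_of_sub_mul_eq {f g : Space e} {l : ℂ} (h : ∀ z, (z - l) * f z = (z - l) * g z) :
    f = g := by
  have hf : Continuous f := f.mem.1.continuous
  have hg : Continuous g := g.mem.1.continuous
  refine Space.ext fun z => ?_
  have hd : Dense ({l}ᶜ : Set ℂ) := dense_compl_singleton _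
  exact congrFun (Continuous.ext_on hd hf hg fun y hy =>
    mul_left_cancel₀ (sub_ne_zero.2 hy) (h y)) z

/-- The resolvent of `S_β` at a point where `s_β` does not vanish. -/
theorem exists_resolvent (he : ∀ x : ℝ, e.toFun x ≠ 0) (β : ℝ) {l : ℂ} (hl : s e β l ≠ 0) :
    ∃ R : Space e →L[ℂ] Space e, ∀ h z, (z - l) * R h z = h z - h l / s e β l * s e β z := by
  choose r hr using fun f : Space e =>
    exists_sub_mul_eq he β f (f l / s e β l) l (div_mul_cancel₀ _ hl).symm
  let g : Space e →ₗ[ℂ] Space e :=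
    { toFun := r
      map_add' := fun f g => ext_of_sub_mul_eq (l := l) fun z => by
        rw [hr, add_apply (r f), mul_add, hr, hr, add_apply, add_apply]
        ring
      map_smul' := fun c f => ext_of_sub_mul_eq (l := l) fun z => by
        rw [hr, RingHom.id_apply, smul_apply c (r f), mul_left_comm, hr, smul_apply, smul_apply]
        ring }
  have hgr : ∀ f z, (z - l) * g f z = f z - f l / s e β l * s e β z := hr
  have := completeSpace he
  -- Boundedness by the closed graph theorem: point evaluations are continuous, so the defining
  -- identity passes to limits.
  refine ⟨ContinuousLinearMap.ofSeqClosedGraph (g := g) fun u f y hu hy =>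
    ext_of_sub_mul_eq (l := l) fun z => ?_, hr⟩
  refine tendsto_nhds_unique ((tendsto_apply he hy z).const_mul (z - l)) ?_
  simp only [Function.comp_apply, hgr]
  exact (tendsto_apply he hu z).sub (((tendsto_apply he hu l).div_const _).mul_const _)

theorem mem_relSpectrum_of_eigenvector {E : Type*} [NormedAddCommGroup E] [NormedSpace ℂ E]
    {T : Set (E × E)} {l : ℂ} {u : E} (hu : u ≠ 0) (h : (u, l • u) ∈ T) : l ∈ relSpectrum T := by
  rintro ⟨R, hR⟩
  refine hu ?_
  have := (hR u (l • u)).1 h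
  rwa [sub_self, map_zero] at this

theorem s_zero_ne_zero (hs : s e 0 ∈ functions e) : Space.mk (s e 0) hs ≠ 0 := by
  intro h
  refine s_ne_zero_of_im_pos e 0 (z := I) (by simp) ?_
  rw [← mk_apply (s e 0) hs, h, zero_apply]

/-- Where `s_0` does not vanish, the explicit resolvent works; at a zero `l`, the function
`s_0(z)/(z - l)` is an eigenvector. Thus `j` and `s_0` have the same zeros. -/
theorem relSpectrum_relS0 (he : ∀ x : ℝ, e.toFun x ≠ 0) (hs : s e 0 ∈ functions e) :
    relSpectrum (relS0 e) = {l | s e 0 l = 0} := by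
  ext l
  rw [mem_ofPred_eq]
  refine ⟨fun h => ?_, fun h => ?_⟩
  · by_contra hl
    obtain ⟨R, hR⟩ := exists_resolvent he 0 hl
    refine h ⟨R, fun u v => ⟨?_, fun huv => ?_⟩⟩
    · rintro ⟨-, c, hc⟩
      simp only at hc
      refine ext_of_sub_mul_eq (l := l) fun z => ?_
      rw [hR]
      simp only [sub_apply, smul_apply, hc]
      field_simp
      ring
    · have h1 : ∀ z, z * u z = v z - (v - l • u) l / s e 0 l * s e 0 z := by
        intro z
        have h2 := hR (v - l • u) z
        rw [← huv] at h2
        rw [sub_apply, smul_apply] at h2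
        linear_combination h2
      refine ⟨?_, (v - l • u) l / s e 0 l, fun z => ?_⟩
      · have h3 : (fun z => z * u z) =
            (v - ((v - l • u) l / s e 0 l) • Space.mk (s e 0) hs : Space e).toFun := by
          funext z
          exact h1 z
        simp only
        rw [h3]
        exact Space.mem _
      · simp only
        linear_combination -h1 z
  · obtain ⟨u, hu⟩ := exists_sub_mul_eq he 0 0 (-1) l (by simp [h])
    simp only [zero_apply] at hu
    refine mem_relSpectrum_of_eigenvector (u := u) ?_ ⟨?_, -1, fun z => ?_⟩
    · rintro rfl
      exact s_zero_ne_zero hs (Space.ext fun z => by simpa using (hu z).symm)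
    · have h3 : (fun z => z * u z) = (l • u + Space.mk (s e 0) hs : Space e).toFun := by
        funext z
        simp only [add_apply, smul_apply, mk_apply]
        linear_combination hu z
      simp only
      rw [h3]
      exact Space.mem _
    · simp only [smul_apply]
      linear_combination -hu z

end DeBranges

/-! ### Eigenvectors of `S_β` and their completeness. -/

namespace DeBranges

variable {e : HermiteBiehler}

theorem integral_div_eq_zero (he : ∀ x : ℝ, e.toFun x ≠ 0) {p q : Space e} {x : ℝ}
    (h : ∀ z, (z - x) * p z = q z) :
    Integrable (fun t : ℝ => p t / e.toFun t) ∧ ∫ t : ℝ, p t / e.toFun t = 0 := by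
  obtain ⟨C, hC, hb⟩ := exists_lintegral_horizontal_le q
  refine integral_eq_zero_of_norm_sub_mul_le (G := fun z => p z / e.toFun z)
    (F := fun z => q z / e.toFun z) (continuousOn_div he p.mem.1) (differentiableOn_div e p.mem.1)
    hC hb x fun z _ => ?_
  rw [← norm_mul, ← h, mul_div_assoc]

/-- Elements of the domain of `S` are orthogonal to `s_β`, in the sense of the integral defining
the inner product. -/
theorem integral_s_mul_div_eq_zero (he : ∀ x : ℝ, e.toFun x ≠ 0) (β : ℝ) {p q : Space e} {x : ℝ}
    (h : ∀ z, (z - x) * p z = q z) :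
    ∫ t : ℝ, s e β t * p t / ((‖e.toFun t‖ : ℂ) ^ 2) = 0 := by
  obtain ⟨hi1, h1⟩ := integral_div_eq_zero he h
  obtain ⟨hi2, h2⟩ := integral_div_eq_zero he (p := p.sharp) (q := q.sharp) (x := x) fun z => by
    rw [Space.sharp_apply, Space.sharp_apply, ← h, map_mul, map_sub, conj_conj, conj_ofReal]
  -- On the real line `e^#` is the conjugate of `e`, so the integrand splits into multiples of `p/e`
  -- and of the conjugate of `p^#/e`, both of integral zero.
  have hpt : ∀ t : ℝ, s e β t * p t / ((‖e.toFun t‖ : ℂ) ^ 2) =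
      I / 2 * exp (I * β) * conj (p.sharp t / e.toFun t) -
        I / 2 * exp (-(I * β)) * (p t / e.toFun t) := by
    intro t
    have h3 : conj (e.toFun t) ≠ 0 := (map_ne_zero _).2 (he t)
    have h4 := he t
    rw [← Complex.conj_mul', s, sharp_ofReal, Space.sharp_apply, conj_ofReal, map_div₀, conj_conj]
    field_simp
  have hi3 : Integrable fun t : ℝ => conj (p.sharp t / e.toFun t) :=
    (conjCLE : ℂ →L[ℝ] ℂ).integrable_comp hi2
  simp_rw [hpt]
  rw [integral_sub (hi3.const_mul _) (hi1.const_mul _), integral_const_mul, integral_const_mul, h1,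
    integral_conj, h2]
  simp

theorem exists_eigenvector (he : ∀ x : ℝ, e.toFun x ≠ 0) {β : ℝ} {l : ℂ} (hl : s e β l = 0) :
    ∃ h : Space e, ∀ z, (z - l) * h z = s e β z := by
  obtain ⟨u, hu⟩ := exists_sub_mul_eq he β 0 (-1) l (by simp [hl])
  exact ⟨u, fun z => by simpa using hu z⟩

section Eigenvector
variable {β x : ℝ} {h : Space e}

/-- Writing `f = (z - x) p` moves the factor `t - x` onto `h`, where it produces `s_β`; the integral
of `s_β p / |e|²` is zero. -/
theorem inner_eq_zero_of_apply_eq_zero (he : ∀ x : ℝ, e.toFun x ≠ 0)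
    (hh : ∀ z, (z - x) * h z = s e β z) {f : Space e} (hf : f x = 0) : inner ℂ h f = 0 := by
  obtain ⟨p, hp⟩ := exists_sub_mul_eq he β f 0 x (by simpa using hf)
  simp only [zero_mul, sub_zero] at hp
  rw [inner_eq_integral, ← integral_s_mul_div_eq_zero he β hp]
  refine integral_congr_ae (Eventually.of_forall fun t => ?_)
  simp only
  congr 1
  have h1 := congrArg conj (hh t)
  rw [conj_s_ofReal, map_mul, map_sub, conj_ofReal, conj_ofReal] at h1
  rw [← hp, ← h1]
  ring

theorem eigenvector_ne_zero (hh : ∀ z, (z - x) * h z = s e β z) : h ≠ 0 := by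
  rintro rfl
  refine s_ne_zero_of_im_pos e β (z := I) (by simp) ?_
  rw [← hh, zero_apply, mul_zero]

theorem eigenvector_apply_ne_zero (he : ∀ x : ℝ, e.toFun x ≠ 0)
    (hh : ∀ z, (z - x) * h z = s e β z) : h x ≠ 0 := fun h0 =>
  eigenvector_ne_zero hh (inner_self_eq_zero.1 (inner_eq_zero_of_apply_eq_zero he hh h0))

/-- The eigenvector `s_β(z) / (z - x)` is a multiple of the reproducing kernel at `x`. -/
theorem inner_eigenvector (he : ∀ x : ℝ, e.toFun x ≠ 0)
    (hh : ∀ z, (z - x) * h z = s e β z) (f : Space e) :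
    inner ℂ h f = (‖h‖ : ℂ) ^ 2 / h x * f x := by
  have h0 := eigenvector_apply_ne_zero he hh
  have h1 := inner_eq_zero_of_apply_eq_zero he hh (f := f - (f x / h x) • h) (by
    rw [sub_apply, smul_apply, div_mul_cancel₀ _ h0, sub_self])
  rw [inner_sub_right, inner_smul_right, inner_self_eq_norm_sq_to_K, sub_eq_zero] at h1
  rw [h1]
  simp only [coe_algebraMap]
  ring

end Eigenvector

/-- At most one of the functions `s_β`, `β ∈ [0, π)`, belongs to the space. -/
theorem s_notMem_functions (hs : s e 0 ∈ functions e) {β : ℝ} (hβ : Real.sin β ≠ 0) :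
    s e β ∉ functions e := by
  intro h
  have hβ' : (Real.sin β : ℂ) ≠ 0 := ofReal_ne_zero.2 hβ
  have h1 : s e (Real.pi / 2) ∈ functions e := by
    have : s e (Real.pi / 2) = (1 / Real.sin β : ℂ) • (s e β - (Real.cos β : ℂ) • s e 0) := by
      funext z
      have := s_eq_cos_mul_add_sin_mul e β 0 z
      rw [sub_zero, zero_add] at this
      simp only [Pi.smul_apply, Pi.sub_apply, smul_eq_mul, this]
      field_simp
      ring
    rw [this]
    exact (functions e).smul_mem _ ((functions e).sub_mem h ((functions e).smul_mem _ hs))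
  -- With two independent `s_β` in the space, `e` would be in it too, but `e/e = 1` is not square
  -- integrable.
  have h2 : e.toFun ∈ functions e := by
    have : e.toFun = -s e (Real.pi / 2) - I • s e 0 := funext fun z => toFun_eq_s e z
    rw [this]
    exact (functions e).sub_mem ((functions e).neg_mem h1) ((functions e).smul_mem _ hs)
  obtain ⟨C, hC, hb⟩ := h2.2.1.bound
  have h3 := hb 1 one_pos
  have h4 : ∀ x : ℝ, ‖e.toFun ((x : ℂ) + ((1 : ℝ) : ℂ) * I) /
      e.toFun ((x : ℂ) + ((1 : ℝ) : ℂ) * I)‖ₑ ^ 2 = 1 := fun x => by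
    rw [div_self (ne_zero_of_im_pos e (by simp))]
    simp
  simp_rw [h4] at h3
  rw [lintegral_one, Real.volume_univ] at h3
  exact absurd (lt_of_le_of_lt h3 hC) (lt_irrefl _)

/-- The elements of the space that vanish at all zeros of `s_β`. -/
def vanishing (e : HermiteBiehler) (β : ℝ) : Submodule ℂ (Space e) where
  carrier := {f | ∀ x : ℝ, s e β x = 0 → f x = 0}
  zero_mem' := fun x _ => zero_apply _
  add_mem' := fun hf hg x hx => by rw [add_apply, hf x hx, hg x hx, add_zero]
  smul_mem' := fun c f hf x hx => by rw [smul_apply, hf x hx, mul_zero]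

theorem isClosed_vanishing (he : ∀ x : ℝ, e.toFun x ≠ 0) (β : ℝ) :
    IsClosed (vanishing e β : Set (Space e)) := by
  have : (vanishing e β : Set (Space e)) =
      ⋂ (x : ℝ) (_ : s e β x = 0), {f | evalCLM he x f = 0} := by
    ext f
    simp [vanishing, evalCLM_apply]
  rw [this]
  exact isClosed_iInter fun x => isClosed_iInter fun _ =>
    isClosed_eq (evalCLM he x).continuous continuous_const

/-- If `s_β(l) ≠ 0`, evaluate at `l`. Otherwise `d` is a multiple of the eigenvector at `l`, which
does not vanish there. This gives uniqueness of quotients within `vanishing e β`. -/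
theorem eq_zero_of_mem_vanishing (he : ∀ x : ℝ, e.toFun x ≠ 0) {β : ℝ} {d : Space e}
    (hd : d ∈ vanishing e β) {c l : ℂ} (h : ∀ z, (z - l) * d z = c * s e β z) : d = 0 := by
  suffices hc : c = 0 from ext_of_sub_mul_eq (l := l) fun z => by simp [h z, hc]
  by_cases hl : s e β l = 0
  · have hlr : ((l.re : ℝ) : ℂ) = l := Complex.ext rfl (im_eq_zero_of_s_eq_zero hl).symm
    obtain ⟨k, hk⟩ := exists_eigenvector he hl
    have hdk : d = c • k := ext_of_sub_mul_eq (l := l) fun z => by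
      rw [h, smul_apply, mul_left_comm, hk]
    have h1 : d l = 0 := by
      rw [← hlr]
      exact hd l.re (by rwa [hlr])
    rw [hdk, smul_apply] at h1
    refine (mul_eq_zero.1 h1).resolve_right ?_
    rw [← hlr] at hk ⊢
    exact eigenvector_apply_ne_zero he hk
  · have := h l
    rw [sub_self, zero_mul] at this
    exact (mul_eq_zero.1 this.symm).resolve_right hl

/-- On this subspace the resolvent exists at every `l`, even at a zero of `s_β`: there `f` vanishes
too, and a multiple of the eigenvector corrects the value of the quotient at `l`. -/
theorem exists_mem_vanishing (he : ∀ x : ℝ, e.toFun x ≠ 0) {β : ℝ} {f : Space e}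
    (hf : f ∈ vanishing e β) (l : ℂ) :
    ∃ u ∈ vanishing e β, ∃ c : ℂ, ∀ z, (z - l) * u z = f z - c * s e β z := by
  have key : ∀ u : Space e, ∀ c : ℂ, (∀ z, (z - l) * u z = f z - c * s e β z) → ∀ x : ℝ,
      s e β x = 0 → (x : ℂ) ≠ l → u x = 0 := by
    intro u c hu x hx hxl
    have := hu x
    rw [hf x hx, hx, mul_zero, sub_zero] at this
    exact (mul_eq_zero.1 this).resolve_left (sub_ne_zero.2 hxl)
  by_cases hl : s e β l = 0
  · have hlr : ((l.re : ℝ) : ℂ) = l := Complex.ext rfl (im_eq_zero_of_s_eq_zero hl).symm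
    obtain ⟨k, hk⟩ := exists_eigenvector he hl
    have hk0 : k l ≠ 0 := by
      rw [← hlr] at hk ⊢
      exact eigenvector_apply_ne_zero he hk
    have hfl : f l = 0 := by
      rw [← hlr]
      exact hf l.re (by rwa [hlr])
    obtain ⟨u, hu⟩ := exists_sub_mul_eq he β f 0 l (by rw [hfl, zero_mul])
    have hv : ∀ z, (z - l) * (u - (u l / k l) • k) z = f z - u l / k l * s e β z := by
      intro z
      rw [sub_apply, smul_apply, mul_sub, hu, mul_left_comm, hk]
      ring
    refine ⟨u - (u l / k l) • k, fun x hx => ?_, u l / k l, hv⟩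
    by_cases hxl : (x : ℂ) = l
    · rw [hxl, sub_apply, smul_apply, div_mul_cancel₀ _ hk0, sub_self]
    · exact key _ _ hv x hx hxl
  · obtain ⟨u, hu⟩ := exists_sub_mul_eq he β f (f l / s e β l) l (div_mul_cancel₀ _ hl).symm
    refine ⟨u, fun x hx => key _ _ hu x hx ?_, _, hu⟩
    rintro rfl
    exact hl hx

/-- Symmetry of division by `z`, up to multiples of `s_β`. -/
theorem inner_div_symm (he : ∀ x : ℝ, e.toFun x ≠ 0) {β : ℝ} {f g u v : Space e} {c d : ℂ}
    (hu : ∀ z, z * u z = f z - c * s e β z) (hv : ∀ z, z * v z = g z - d * s e β z) :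
    inner ℂ u g = inner ℂ f v := by
  have hf0 : f 0 = c * s e β 0 := by
    have := hu 0
    rw [zero_mul] at this
    exact (sub_eq_zero.1 this.symm)
  have hg0 : g 0 = d * s e β 0 := by
    have := hv 0
    rw [zero_mul] at this
    exact (sub_eq_zero.1 this.symm)
  have hs0 : conj (s e β 0) = s e β 0 := by simpa using conj_s_ofReal e β 0
  -- On the real line `t (conj u · g - conj f · v) = s_β (d conj f - conj c · g)`. The last factor
  -- extends to an entire function vanishing at `0`; its quotient `p` by `z` is in the space, so
  -- `s_β p / |e|²` has integral zero.
  obtain ⟨p, hp⟩ := exists_sub_mul_eq he β (d • f.sharp - conj c • g) 0 ((0 : ℝ) : ℂ) (by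
    rw [sub_apply, smul_apply, smul_apply, Space.sharp_apply, ofReal_zero, map_zero, hf0, hg0,
      map_mul, hs0]
    ring)
  simp only [zero_mul, sub_zero] at hp
  have h0 := integral_s_mul_div_eq_zero he β hp
  rw [← sub_eq_zero, inner_eq_integral, inner_eq_integral,
    ← integral_sub (integrable_inner u g) (integrable_inner f v), ← h0]
  refine integral_congr_ae ?_
  filter_upwards [compl_mem_ae_iff.2 (measure_singleton (μ := (volume : Measure ℝ)) 0)] with t ht
  have ht0 : (t : ℂ) ≠ 0 := ofReal_ne_zero.2 ht
  rw [← sub_div]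
  congr 1
  refine mul_left_cancel₀ ht0 ?_
  have h1 := congrArg conj (hu t)
  rw [map_mul, map_sub, map_mul, conj_s_ofReal, conj_ofReal] at h1
  have h2 := hv t
  have h3 := hp t
  simp only [sub_apply, smul_apply, Space.sharp_apply, ofReal_zero, sub_zero, conj_ofReal] at h3
  linear_combination g t * h1 - conj (f t) * h2 - s e β t * h3

/-- The eigenvectors of `S_β` are complete: an element of the space that vanishes at all zeros of
`s_β` is zero. -/
theorem vanishing_eq_bot (he : ∀ x : ℝ, e.toFun x ≠ 0) (hs : s e 0 ∈ functions e) {β : ℝ}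
    (hβ : Real.sin β ≠ 0) : vanishing e β = ⊥ := by
  have := completeSpace he
  have : CompleteSpace (vanishing e β) := (isClosed_vanishing he β).completeSpace_coe
  choose r hrV c hr using fun f : vanishing e β => exists_mem_vanishing he f.2 0
  simp only [sub_zero] at hr
  -- `A` is division by `z` modulo `s_β`, the inverse of `S_β` on the subspace. Being symmetric and
  -- everywhere defined, it is bounded (Hellinger–Toeplitz).
  let A : vanishing e β →ₗ[ℂ] vanishing e β :=
    { toFun := fun f => ⟨r f, hrV f⟩
      map_add' := fun f g => Subtype.ext (sub_eq_zero.1 (eq_zero_of_mem_vanishing he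
        (d := r (f + g) - (r f + r g)) (c := c f + c g - c (f + g)) (l := 0)
        (Submodule.sub_mem _ (hrV _) (Submodule.add_mem _ (hrV _) (hrV _))) fun z => by
          have h1 := hr (f + g) z
          rw [Submodule.coe_add, add_apply] at h1
          rw [sub_apply, add_apply]
          linear_combination h1 - hr f z - hr g z))
      map_smul' := fun a f => Subtype.ext (sub_eq_zero.1 (eq_zero_of_mem_vanishing he
        (d := r (a • f) - a • r f) (c := a * c f - c (a • f)) (l := 0)
        (Submodule.sub_mem _ (hrV _) (Submodule.smul_mem _ _ (hrV _))) fun z => by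
          have h1 := hr (a • f) z
          rw [Submodule.coe_smul, smul_apply] at h1
          rw [sub_apply, smul_apply]
          linear_combination h1 - a * hr f z)) }
  have hA : ∀ (f : vanishing e β) z, z * (A f : Space e) z = (f : Space e) z - c f * s e β z := hr
  have hsymm : A.IsSymmetric := fun f g => inner_div_symm he (hA f) (hA g)
  let T : vanishing e β →L[ℂ] vanishing e β := ⟨A, hsymm.continuous⟩
  have hT : ∀ (f : vanishing e β) z, z * (T f : Space e) z = (f : Space e) z - c f * s e β z := hr
  have hsa : IsSelfAdjoint T := ContinuousLinearMap.isSelfAdjoint_iff_isSymmetric.2 hsymm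
  have hspec : ∀ k ∈ spectrum ℂ T, k = 0 := by
    intro k hk
    by_contra hk0
    refine hk ?_
    rw [spectrum.mem_resolventSet_iff, ContinuousLinearMap.isUnit_iff_bijective]
    have happ : ∀ f, (algebraMap ℂ (vanishing e β →L[ℂ] vanishing e β) k - T) f = k • f - T f :=
      fun f => rfl
    refine ⟨(injective_iff_map_eq_zero _).2 fun f hf => ?_, fun g => ?_⟩
    · rw [happ, sub_eq_zero] at hf
      have h1 : ((T f : vanishing e β) : Space e) = 0 :=
        eq_zero_of_mem_vanishing he (T f).2 (c := -c f) (l := 1 / k) fun z => by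
          have h2 := hT f z
          have h3 : k * (f : Space e) z = (T f : Space e) z := by
            rw [← hf, Submodule.coe_smul, smul_apply]
          field_simp
          linear_combination k * h2 + h3
      have h4 : T f = 0 := Subtype.ext h1
      rw [h4] at hf
      exact (smul_eq_zero.1 hf).resolve_left hk0
    -- Let `u` be the quotient of `g/k` by `z - 1/k`, modulo `s_β`. Then `h = (g + u)/k` satisfies
    -- `z u = h - a s_β`, so `T h = u` and `k h - T h = g`.
    · obtain ⟨u, huV, a, hu⟩ := exists_mem_vanishing he
        (Submodule.smul_mem _ (1 / k) g.2) (1 / k)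
      refine ⟨(1 / k) • (g + ⟨u, huV⟩), ?_⟩
      have h1 : T ((1 / k) • (g + ⟨u, huV⟩)) = ⟨u, huV⟩ :=
        Subtype.ext (sub_eq_zero.1 (eq_zero_of_mem_vanishing he
          (c := a - c ((1 / k) • (g + ⟨u, huV⟩))) (l := 0)
          (Submodule.sub_mem _ (T _).2 huV) fun z => by
            have h2 := hT ((1 / k) • (g + ⟨u, huV⟩)) z
            rw [Submodule.coe_smul, smul_apply, Submodule.coe_add, add_apply] at h2
            have h3 := hu z
            rw [smul_apply] at h3
            rw [sub_apply]
            simp only at h2 ⊢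
            linear_combination h2 - h3))
      rw [happ, h1, smul_smul, mul_one_div_cancel hk0, one_smul, add_sub_cancel_right]
  -- The norm of a selfadjoint operator is its spectral radius.
  have hT0 : T = 0 := by
    have h1 := T.spectralRadius_eq_nnnorm hsa
    have h2 : spectralRadius ℂ T = 0 := by
      simp only [spectralRadius, ENNReal.iSup_eq_zero]
      intro k hk
      simp [hspec k hk]
    rw [h2] at h1
    have h3 : ‖T‖ = 0 := congrArg NNReal.toReal (ENNReal.coe_eq_zero.1 h1.symm)
    refine ContinuousLinearMap.ext fun f => norm_le_zero_iff.1 ?_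
    refine (T.le_opNorm f).trans (le_of_eq ?_)
    rw [h3, zero_mul]
  refine (Submodule.eq_bot_iff _).2 fun f hf => ?_
  have h1 : ∀ z, f z = c ⟨f, hf⟩ * s e β z := by
    intro z
    have := hT ⟨f, hf⟩ z
    rw [hT0] at this
    simp only [_root_.zero_apply, ZeroMemClass.coe_zero, zero_apply, mul_zero] at this
    exact sub_eq_zero.1 this.symm
  have h2 : c ⟨f, hf⟩ = 0 := by
    by_contra hc
    refine s_notMem_functions hs hβ ?_
    have : s e β = (1 / c ⟨f, hf⟩) • (f : ℂ → ℂ) := by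
      funext z
      rw [Pi.smul_apply, h1, smul_eq_mul]
      field_simp
    rw [this]
    exact (functions e).smul_mem _ f.mem
  exact Space.ext fun z => by rw [h1, h2, zero_mul, zero_apply]

end DeBranges

/-! ### The spectrum of `S_β`, the eigenbasis and the isometry `U_β`. -/

namespace DeBranges

variable {e : HermiteBiehler}

theorem mem_opS_of_eigenvector (he : ∀ x : ℝ, e.toFun x ≠ 0) {β : ℝ} (hβ : Real.sin β ≠ 0) {x : ℝ}
    {h : Space e} (hh : ∀ z, (z - x) * h z = s e β z) : (h, (x : ℂ) • h) ∈ opS e β := by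
  have hβ' : (Real.sin β : ℂ) ≠ 0 := ofReal_ne_zero.2 hβ
  have h0 := eigenvector_apply_ne_zero he hh
  have hx : s e β x = 0 := by rw [← hh, sub_self, zero_mul]
  have hfx : ((-Real.sin β / h x : ℂ) • h) x = -Real.sin β := by
    rw [smul_apply, div_mul_cancel₀ _ h0]
  -- With `w = x` and `s_β(x) = 0` only the value `f(x)` enters the defining formula, and it has to
  -- be `-sin β`.
  refine ⟨(-Real.sin β / h x : ℂ) • h, x, fun z hz => ?_, fun z => ?_⟩
  · rw [hx, hfx, ← hh]
    have : z - x ≠ 0 := sub_ne_zero.2 hz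
    field_simp
    ring
  · rw [hfx, smul_apply, ← hh]
    field_simp
    ring

theorem eigenspace_eq_span (he : ∀ x : ℝ, e.toFun x ≠ 0) {β : ℝ} (hβ : Real.sin β ≠ 0) {x : ℝ}
    {h : Space e} (hh : ∀ z, (z - x) * h z = s e β z) :
    eigenspace e β x = Submodule.span ℂ {h} := by
  refine le_antisymm (Submodule.span_le.2 ?_) (Submodule.span_mono ?_)
  · rintro g ⟨f, w, -, hg⟩
    refine Submodule.mem_span_singleton.2 ⟨-(1 / Real.sin β * f w), ?_⟩
    refine ext_of_sub_mul_eq (l := x) fun z => ?_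
    have h1 := hg z
    simp only [smul_apply] at h1
    rw [smul_apply, mul_left_comm, hh]
    linear_combination h1
  · rintro g rfl
    exact mem_opS_of_eigenvector he hβ hh

theorem mem_realSpec_iff (he : ∀ x : ℝ, e.toFun x ≠ 0) {β : ℝ} (hβ : Real.sin β ≠ 0) {x : ℝ} :
    x ∈ realSpec e β ↔ s e β x = 0 := by
  have hβ' : (Real.sin β : ℂ) ≠ 0 := ofReal_ne_zero.2 hβ
  refine ⟨fun h => ?_, fun hx => ?_⟩
  · by_contra hl
    obtain ⟨R, hR⟩ := exists_resolvent he β hl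
    refine h ⟨R, fun u v => ⟨?_, fun huv => ?_⟩⟩
    · rintro ⟨f, w, -, hv⟩
      simp only at hv
      refine ext_of_sub_mul_eq (l := x) fun z => ?_
      rw [hR]
      simp only [sub_apply, smul_apply, hv]
      field_simp
      ring
    · have h1 : ∀ z, (z - x) * u z =
          (v - (x : ℂ) • u) z - (v - (x : ℂ) • u) x / s e β x * s e β z := by
        intro z
        have h2 := hR (v - (x : ℂ) • u) z
        rwa [← huv] at h2
      set k := v - (x : ℂ) • u
      have hk : ∀ z, v z = x * u z + k z := fun z => by
        simp only [k, sub_apply, smul_apply]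
        ring
      -- For `w = x` the formula defining `S_β` is the resolvent formula at `x`, rescaled by `sin β
      -- / s_β(x)`.
      refine ⟨(Real.sin β / s e β x : ℂ) • k, x, fun z hz => ?_, fun z => ?_⟩
      · have h3 : z - x ≠ 0 := sub_ne_zero.2 hz
        simp only [smul_apply]
        rw [eq_div_iff (mul_ne_zero hβ' h3)]
        have h4 := h1 z
        field_simp at h4 ⊢
        linear_combination h4
      · simp only [smul_apply]
        rw [hk]
        have h4 := h1 z
        field_simp at h4 ⊢
        linear_combination -h4
  · obtain ⟨h, hh⟩ := exists_eigenvector he hx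
    exact mem_relSpectrum_of_eigenvector (eigenvector_ne_zero hh) (mem_opS_of_eigenvector he hβ hh)

/-- The normalized eigenvectors of `S_β` form an orthonormal basis. -/
theorem exists_hilbertBasis_eigenvectors (he : ∀ x : ℝ, e.toFun x ≠ 0)
    (hs : s e 0 ∈ functions e) {β : ℝ} (hβ : Real.sin β ≠ 0) :
    ∃ (b : HilbertBasis (realSpec e β) ℂ (Space e)) (κ : realSpec e β → ℂ), (∀ x, κ x ≠ 0) ∧
      (∀ (x : realSpec e β) (v : Space e), inner ℂ (b x) v = κ x * v (x : ℝ)) ∧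
      ∀ (x : realSpec e β) (v : Space e), E e β x v = inner ℂ (b x) v • b x := by
  have := completeSpace he
  choose h hh using fun x : realSpec e β => exists_eigenvector he ((mem_realSpec_iff he hβ).1 x.2)
  have hn : ∀ x, (‖h x‖ : ℂ) ≠ 0 := fun x =>
    ofReal_ne_zero.2 (norm_ne_zero_iff.2 (eigenvector_ne_zero (hh x)))
  have h0 := fun x => eigenvector_apply_ne_zero he (hh x)
  set v : realSpec e β → Space e := fun x => (‖h x‖ : ℂ)⁻¹ • h x
  have hvn : ∀ x, ‖v x‖ = 1 := fun x => by
    simp only [v, norm_smul, norm_inv, norm_real, norm_norm]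
    exact inv_mul_cancel₀ (norm_ne_zero_iff.2 (eigenvector_ne_zero (hh x)))
  have hvi : ∀ x f, inner ℂ (v x) f = (‖h x‖ : ℂ) / h x (x : ℝ) * f (x : ℝ) := fun x f => by
    simp only [v]
    rw [inner_smul_left, inner_eigenvector he (hh x), map_inv₀, conj_ofReal]
    have := hn x
    field_simp
  have hκ : ∀ x, (‖h x‖ : ℂ) / h x (x : ℝ) ≠ 0 := fun x => div_ne_zero (hn x) (h0 x)
  have horth : Orthonormal ℂ v := by
    refine ⟨hvn, fun x y hxy => ?_⟩
    have h1 : h y (x : ℝ) = 0 := by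
      have := hh y (x : ℝ)
      rw [(mem_realSpec_iff he hβ).1 x.2] at this
      refine (mul_eq_zero.1 this).resolve_left (sub_ne_zero.2 fun hc => hxy ?_)
      exact Subtype.ext (ofReal_injective hc)
    change inner ℂ (v x) (v y) = 0
    rw [hvi]
    simp [v, h1]
  -- Orthogonality to the eigenvector at `x` forces the value at `x` to vanish, so the orthogonal
  -- complement lies in `vanishing e β`.
  have hspan : (Submodule.span ℂ (range v))ᗮ = ⊥ := by
    rw [← le_bot_iff, ← vanishing_eq_bot he hs hβ]
    intro f hf x hx
    have h1 := (Submodule.mem_orthogonal _ f).1 hf (v ⟨x, (mem_realSpec_iff he hβ).2 hx⟩)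
      (Submodule.subset_span (mem_range_self _))
    rw [hvi] at h1
    exact (mul_eq_zero.1 h1).resolve_left (hκ _)
  refine ⟨HilbertBasis.mkOfOrthogonalEqBot horth hspan, fun x => (‖h x‖ : ℂ) / h x (x : ℝ), hκ,
    fun x f => ?_, fun x f => ?_⟩
  · rw [HilbertBasis.coe_mkOfOrthogonalEqBot, hvi]
  · rw [HilbertBasis.coe_mkOfOrthogonalEqBot]
    refine Submodule.eq_starProjection_of_mem_of_inner_eq_zero ?_ fun g hg => ?_
    · rw [eigenspace_eq_span he hβ (hh x)]
      exact Submodule.smul_mem _ _ (Submodule.smul_mem _ _ (Submodule.mem_span_singleton_self _))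
    · rw [eigenspace_eq_span he hβ (hh x)] at hg
      obtain ⟨c, rfl⟩ := Submodule.mem_span_singleton.1 hg
      have h1 : c • h x = (c * ‖h x‖) • v x := by
        simp only [v, smul_smul, mul_assoc, mul_inv_cancel₀ (hn x), mul_one]
      rw [h1, inner_smul_right, inner_sub_left, inner_smul_left, inner_self_eq_norm_sq_to_K, hvn]
      simp

/-- The mass of `m_β` at `x` is `|⟨b x, s_0⟩|²`, so the `L²` norm is the `ℓ²` norm of the
coefficients of `U_β f`. -/
theorem memLp_m_iff (hs : s e 0 ∈ functions e) {β : ℝ}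
    (b : HilbertBasis (realSpec e β) ℂ (Space e))
    (hE : ∀ (x : realSpec e β) (v : Space e), E e β x v = inner ℂ (b x) v • b x)
    {f : ℝ → ℂ} (hf : Measurable f) :
    MemLp f 2 (m e hs β) ↔
      Summable fun x : realSpec e β => ‖f x * inner ℂ (b x) (Space.mk (s e 0) hs)‖ ^ 2 := by
  have h1 : ∀ x : realSpec e β, ENNReal.ofReal
      (inner ℂ (Space.mk (s e 0) hs) (E e β x (Space.mk (s e 0) hs))).re * ‖f x‖ₑ ^ 2 =
      ENNReal.ofReal (‖f x * inner ℂ (b x) (Space.mk (s e 0) hs)‖ ^ 2) := by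
    intro x
    rw [hE, inner_smul_right, ← inner_conj_symm (Space.mk (s e 0) hs) (b x), mul_conj, ofReal_re,
      normSq_eq_norm_sq, ← ofReal_norm, ← ENNReal.ofReal_pow (norm_nonneg _),
      ← ENNReal.ofReal_mul (by positivity), norm_mul, mul_pow, mul_comm]
  have h2 : ∫⁻ t, ‖f t‖ₑ ^ (2 : ℝ≥0∞).toReal ∂(m e hs β) = ∑' x : realSpec e β,
      ENNReal.ofReal (‖f x * inner ℂ (b x) (Space.mk (s e 0) hs)‖ ^ 2) := by
    rw [m, spectralMeasure, lintegral_sum_measure]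
    refine tsum_congr fun x => ?_
    rw [lintegral_smul_measure, lintegral_dirac' _ (by fun_prop), ← h1]
    simp
  rw [MemLp, and_iff_right hf.aestronglyMeasurable,
    eLpNorm_lt_top_iff_lintegral_rpow_enorm_lt_top (by norm_num) (by norm_num), h2]
  refine ⟨fun h => ?_, fun h => h.tsum_ofReal_lt_top⟩
  refine (ENNReal.summable_toReal h.ne).congr fun x => ?_
  rw [ENNReal.toReal_ofReal (by positivity)]

theorem measurable_one_div_ofReal {j : ℂ → ℂ} (hj : Differentiable ℂ j) :
    Measurable fun t : ℝ => 1 / j t :=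
  measurable_const.div (hj.continuous.comp continuous_ofReal).measurable

/-- The functions `s_β` and `s_0` have no common real zeros. -/
theorem s_zero_apply_ne_zero (he : ∀ x : ℝ, e.toFun x ≠ 0) {β : ℝ} (hβ : Real.sin β ≠ 0) {x : ℝ}
    (hx : s e β x = 0) : s e 0 x ≠ 0 := by
  intro h0
  have h1 := s_eq_cos_mul_add_sin_mul e β 0 x
  rw [hx, h0, mul_zero, zero_add, zero_add, sub_zero, eq_comm, mul_eq_zero] at h1
  refine he x ?_
  rw [toFun_eq_s, h0, h1.resolve_left (ofReal_ne_zero.2 hβ)]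
  simp

/-- Coefficients in the eigenbasis are fixed multiples of point values, and `G = s_0/j` at the
points of `spec(S_β)`. -/
theorem quotient_eq_U (he : ∀ x : ℝ, e.toFun x ≠ 0) (hs : s e 0 ∈ functions e) {j : ℂ → ℂ}
    (hj : Differentiable ℂ j) {G : Space e} (hG : ∀ z, G z * j z = s e 0 z) {β : ℝ}
    (hβ : Real.sin β ≠ 0) :
    MemLp (fun t : ℝ => 1 / j t) 2 (m e hs β) ∧ G = U e hs β (fun t : ℝ => 1 / j t) := by
  obtain ⟨b, κ, hκ, hb, hE⟩ := exists_hilbertBasis_eigenvectors he hs hβ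
  have hcoef : ∀ x : realSpec e β, 1 / j (x : ℝ) * inner ℂ (b x) (Space.mk (s e 0) hs) =
      inner ℂ (b x) G := by
    intro x
    have h0 := s_zero_apply_ne_zero he hβ ((mem_realSpec_iff he hβ).1 x.2)
    rw [← hG] at h0
    have hjx := right_ne_zero_of_mul h0
    rw [hb, hb, mk_apply, ← hG]
    field_simp
  refine ⟨?_, ?_⟩
  · rw [memLp_m_iff hs b hE (measurable_one_div_ofReal hj)]
    simp_rw [hcoef]
    exact b.orthonormal.inner_products_summable G
  · have h1 := (b.hasSum_repr G).tsum_eq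
    rw [U, funCalc, ← h1]
    refine tsum_congr fun x => ?_
    rw [hE, smul_smul, hcoef, b.repr_apply_apply]

/-- Interpolation: `U_β f` takes the values `f(x) s_0(x)` at the points `x` of `spec(S_β)`. -/
theorem U_apply (he : ∀ x : ℝ, e.toFun x ≠ 0) (hs : s e 0 ∈ functions e) {β : ℝ}
    (hβ : Real.sin β ≠ 0) {f : ℝ → ℂ} (hf : Measurable f) (hm : MemLp f 2 (m e hs β)) {x : ℝ}
    (hx : s e β x = 0) : U e hs β f x = f x * s e 0 x := by
  have := completeSpace he
  obtain ⟨b, κ, hκ, hb, hE⟩ := exists_hilbertBasis_eigenvectors he hs hβ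
  rw [memLp_m_iff hs b hE hf] at hm
  have hsum : Summable fun y : realSpec e β => f y • E e β y (Space.mk (s e 0) hs) := by
    have h1 := (b.orthonormal.orthogonalFamily.summable_iff_norm_sq_summable
      fun y : realSpec e β => f y * inner ℂ (b y) (Space.mk (s e 0) hs)).2 hm
    refine h1.congr fun y => ?_
    rw [hE, smul_smul, LinearIsometry.toSpanSingleton_apply]
  have h2 := hsum.hasSum
  set x' : realSpec e β := ⟨x, (mem_realSpec_iff he hβ).2 hx⟩
  have h3 := h2.mapL (innerSL ℂ (b x'))
  have horth := orthonormal_iff_ite.1 b.orthonormal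
  have h4 : inner ℂ (b x') (U e hs β f) = f x * inner ℂ (b x') (Space.mk (s e 0) hs) := by
    have h5 : ∀ y : realSpec e β, innerSL ℂ (b x') (f y • E e β y (Space.mk (s e 0) hs)) =
        if x' = y then f y * inner ℂ (b y) (Space.mk (s e 0) hs) else 0 := fun y => by
      rw [innerSL_apply_apply, hE, inner_smul_right, inner_smul_right, horth]
      split_ifs <;> simp
    refine h3.unique ?_
    simp_rw [h5]
    simpa using hasSum_single x' fun y hy => if_neg (Ne.symm hy)
  rw [hb, hb, mk_apply] at h4
  exact mul_left_cancel₀ (hκ x') (h4.trans (by ring))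

/-- Near a zero of `s_γ` the functions `s_β` with `β` near `γ` have zeros. -/
theorem frequently_eq_zero {γ : ℝ} {x₀ : ℝ} (he : ∀ x : ℝ, e.toFun x ≠ 0) (hx₀ : s e γ x₀ = 0)
    {J : Set ℝ} (hJ : AccPt γ (𝓟 J)) {D : ℂ → ℂ}
    (hD : ∀ β ∈ J, ∀ x : ℝ, s e β x = 0 → D x = 0) : ∃ᶠ z in 𝓝[≠] (x₀ : ℂ), D z = 0 := by
  have hC : s e (γ + Real.pi / 2) x₀ ≠ 0 := by
    intro hC
    have h1 := s_eq_cos_mul_add_sin_mul e 0 γ x₀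
    have h2 := s_eq_cos_mul_add_sin_mul e (Real.pi / 2) γ x₀
    rw [hx₀, hC] at h1 h2
    refine he x₀ ?_
    rw [toFun_eq_s, h1, h2]
    ring
  have hAd := differentiable_s e γ
  have hCd := differentiable_s e (γ + Real.pi / 2)
  have hCne : ∀ᶠ z in 𝓝 (x₀ : ℂ), s e (γ + Real.pi / 2) z ≠ 0 :=
    hCd.continuous.continuousAt.eventually_ne hC
  -- By the rotation formula, `s_β` vanishes wherever this quotient equals `-tan (β - γ)`, for `β`
  -- near `γ`. The quotient is nonconstant and zero at `x₀`, so by the open mapping theorem it takes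
  -- these small values near `x₀`.
  have han : AnalyticAt ℂ (fun z => s e γ z / s e (γ + Real.pi / 2) z) x₀ :=
    (hAd.analyticAt _).div (hCd.analyticAt _) hC
  have hopen := han.eventually_constant_or_nhds_le_map_nhds.resolve_left (by
    intro hc
    have h1 : s e γ =ᶠ[𝓝 (x₀ : ℂ)] fun _ => 0 := by
      filter_upwards [hc, hCne] with z hz hz'
      rw [hx₀, zero_div, div_eq_zero_iff] at hz
      exact hz.resolve_right hz'
    have h2 := AnalyticOnNhd.eq_of_eventuallyEq (fun z _ => hAd.analyticAt z)
      (fun z _ => analyticAt_const) h1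
    exact s_ne_zero_of_im_pos e γ (z := I) (by simp) (congrFun h2 I))
  rw [hx₀, zero_div] at hopen
  rw [frequently_nhdsWithin_iff, frequently_iff]
  intro W hW
  have himg := hopen (image_mem_map (inter_mem hW hCne))
  have htan : Tendsto (fun β : ℝ => ((-Real.tan (β - γ) : ℝ) : ℂ)) (𝓝 γ) (𝓝 0) := by
    have hc : ContinuousAt (fun β : ℝ => ((-Real.tan (β - γ) : ℝ) : ℂ)) γ := by
      have h1 : ContinuousAt Real.tan (γ - γ) := by
        rw [sub_self]
        exact Real.continuousAt_tan.2 (by simp)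
      have h2 : ContinuousAt (fun β : ℝ => Real.tan (β - γ)) γ :=
        ContinuousAt.comp (f := fun β : ℝ => β - γ) h1 (by fun_prop)
      exact continuous_ofReal.continuousAt.comp h2.neg
    have h3 := hc.tendsto
    simpa using h3
  have hnear : ∀ᶠ β in 𝓝 γ, |β - γ| < Real.pi / 2 := by
    have : Tendsto (fun β : ℝ => |β - γ|) (𝓝 γ) (𝓝 |γ - γ|) :=
      (by fun_prop : Continuous fun β : ℝ => |β - γ|).tendsto γ
    rw [sub_self, abs_zero] at this
    exact this.eventually (gt_mem_nhds (by positivity))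
  rw [accPt_iff_frequently] at hJ
  obtain ⟨β, ⟨hβγ, hβJ⟩, ⟨z, ⟨hzW, hzC⟩, hz⟩, hlt⟩ :=
    (hJ.and_eventually ((htan.eventually himg).and hnear)).exists
  have hzC' : s e (γ + Real.pi / 2) z ≠ 0 := hzC
  have hcos : (Real.cos (β - γ) : ℂ) ≠ 0 :=
    ofReal_ne_zero.2 (Real.cos_pos_of_mem_Ioo (abs_lt.1 hlt)).ne'
  have hsin : (Real.sin (β - γ) : ℂ) ≠ 0 := by
    refine ofReal_ne_zero.2 fun h => sub_ne_zero.2 hβγ ?_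
    have := abs_lt.1 hlt
    have hp := Real.pi_pos
    exact (Real.sin_eq_zero_iff_of_lt_of_lt (by linarith) (by linarith)).1 h
  have hsz : s e β z = 0 := by
    rw [s_eq_cos_mul_add_sin_mul e β γ z]
    simp only at hz
    rw [div_eq_iff hzC', Real.tan_eq_sin_div_cos] at hz
    rw [hz]
    push_cast at hcos ⊢
    field_simp
    ring
  have hzr : ((z.re : ℝ) : ℂ) = z := Complex.ext rfl (im_eq_zero_of_s_eq_zero hsz).symm
  refine ⟨z, hzW, ?_, ?_⟩
  · rw [← hzr]
    refine hD β hβJ _ ?_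
    rwa [hzr]
  -- The zero found is not `x₀` itself, since `s_β(x₀) = sin (β - γ) s_{γ+π/2}(x₀) ≠ 0`.
  · rintro rfl
    rw [s_eq_cos_mul_add_sin_mul e β γ, hx₀, mul_zero, zero_add] at hsz
    exact (mul_ne_zero hsin hC) hsz

end DeBranges

/-! ### The identity theorem argument and the conclusion. -/

namespace DeBranges

/-- For `β ∈ (0, π)` the spectrum of `S_β` is nonempty. -/
theorem exists_s_eq_zero {e : HermiteBiehler} (he : ∀ x : ℝ, e.toFun x ≠ 0)
    (hs : s e 0 ∈ functions e) {β : ℝ} (hβ : Real.sin β ≠ 0) : ∃ x : ℝ, s e β x = 0 := by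
  by_contra! h
  -- Without zeros the vanishing condition is empty, so the nonzero element `s_0` would lie in the
  -- trivial subspace.
  have h1 : Space.mk (s e 0) hs ∈ vanishing e β := fun x hx => absurd hx (h x)
  rw [vanishing_eq_bot he hs hβ] at h1
  exact s_zero_ne_zero hs h1

/-- As `G = U_β (1/j)` is the same for all `β ∈ J`, interpolation makes `G j - s_0` vanish on all
spectra at once, and these accumulate at `x₀`. -/
theorem exists_quotient {e : HermiteBiehler} (he : ∀ x : ℝ, e.toFun x ≠ 0)
    (hs : s e 0 ∈ functions e) {j : ℂ → ℂ} (hjd : Differentiable ℂ j)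
    (hj : ∀ z, j z = 0 → s e 0 z = 0) {J : Set ℝ} (hJ : J ⊆ Ioo 0 Real.pi) {γ x₀ : ℝ}
    (hγ : AccPt γ (𝓟 J)) (hx₀ : s e γ x₀ = 0)
    (hm : ∀ β ∈ J, MemLp (fun t : ℝ => 1 / j t) 2 (m e hs β))
    (hU : ∀ β ∈ J, ∀ β' ∈ J, U e hs β (fun t : ℝ => 1 / j t) = U e hs β' (fun t : ℝ => 1 / j t)) :
    ∃ G : Space e, ∀ z, G z * j z = s e 0 z := by
  have hsin : ∀ β ∈ J, Real.sin β ≠ 0 := fun β hβ =>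
    (Real.sin_pos_of_mem_Ioo (hJ hβ)).ne'
  obtain ⟨β₁, -, hβ₁⟩ := (accPt_iff_frequently.1 hγ).exists
  set G := U e hs β₁ (fun t : ℝ => 1 / j t)
  have hD : ∀ β ∈ J, ∀ x : ℝ, s e β x = 0 → G x * j x - s e 0 x = 0 := by
    intro β hβ x hx
    have h0 := s_zero_apply_ne_zero he (hsin β hβ) hx
    have hjx : j x ≠ 0 := fun h => h0 (hj x h)
    have h1 : G = U e hs β (fun t : ℝ => 1 / j t) := hU β₁ hβ₁ β hβ
    rw [h1, U_apply he hs (hsin β hβ) (measurable_one_div_ofReal hjd) (hm β hβ) hx]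
    field_simp
    ring
  have hfreq := frequently_eq_zero he hx₀ hγ (D := fun z => G z * j z - s e 0 z) hD
  have hd : Differentiable ℂ fun z => G z * j z - s e 0 z :=
    (G.mem.1.mul hjd).sub (differentiable_s e 0)
  have hz := AnalyticOnNhd.eq_of_frequently_eq (fun z _ => hd.analyticAt z)
    (fun z _ => analyticAt_const (v := (0 : ℂ))) hfreq
  exact ⟨G, fun z => sub_eq_zero.1 (congrFun hz z)⟩

theorem s_pi (e : HermiteBiehler) (z : ℂ) : s e Real.pi z = -s e 0 z := by
  rw [s_eq_cos_mul_add_sin_mul e Real.pi 0 z]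
  simp

end DeBranges

theorem mainTheorem4 (e : HermiteBiehler) (he : ∀ x : ℝ, e.toFun x ≠ 0)
    (hs : DeBranges.s e 0 ∈ DeBranges.functions e)
    (j : ℂ → ℂ)
    (hj : DeBranges.IsRealEntireWithSimpleZeros j
      (DeBranges.relSpectrum (DeBranges.relS0 e))) :
    -- if the entire function `G = s_0 / j_0` is in `B` ...
    (∀ G : DeBranges.Space e, (∀ z : ℂ, G z * j z = DeBranges.s e 0 z) →
      ∀ β ∈ Ioo 0 Real.pi,
        MemLp (fun t : ℝ => 1 / j t) 2 (DeBranges.m e hs β) ∧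
        G = DeBranges.U e hs β (fun t : ℝ => 1 / j t)) ∧
    -- conversely
    (∀ J : Set ℝ, J ⊆ Ioo 0 Real.pi →
      (∃ β₀ : ℝ, AccPt β₀ (𝓟 J) ∧
        (β₀ ∈ Ioo 0 Real.pi ∨ (DeBranges.relSpectrum (DeBranges.relS0 e)).Nonempty)) →
      (∀ β ∈ J, MemLp (fun t : ℝ => 1 / j t) 2 (DeBranges.m e hs β)) →
      (∀ β ∈ J, ∀ β' ∈ J, DeBranges.U e hs β (fun t : ℝ => 1 / j t) =
        DeBranges.U e hs β' (fun t : ℝ => 1 / j t)) →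
      ∃ G : DeBranges.Space e, ∀ z : ℂ, G z * j z = DeBranges.s e 0 z) := by
  refine ⟨fun G hG β hβ => DeBranges.quotient_eq_U he hs hj.entire hG
    (Real.sin_pos_of_mem_Ioo hβ).ne', ?_⟩
  rintro J hJ ⟨γ, hγ, hcase⟩ hm hU
  have hzeros : ∀ z, j z = 0 ↔ DeBranges.s e 0 z = 0 := fun z => by
    rw [hj.zeros, DeBranges.relSpectrum_relS0 he hs, mem_ofPred_eq]
  suffices h : ∃ x₀ : ℝ, DeBranges.s e γ x₀ = 0 by
    obtain ⟨x₀, hx₀⟩ := h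
    exact DeBranges.exists_quotient he hs hj.entire (fun z => (hzeros z).1) hJ hγ hx₀ hm hU
  have hγc : γ ∈ Icc 0 Real.pi := by
    have h1 : γ ∈ closure J := mem_closure_iff_clusterPt.2 hγ.clusterPt
    exact (closure_minimal (hJ.trans Ioo_subset_Icc_self) isClosed_Icc) h1
  by_cases hIoo : γ ∈ Ioo 0 Real.pi
  · exact DeBranges.exists_s_eq_zero he hs (Real.sin_pos_of_mem_Ioo hIoo).ne'
  · obtain ⟨l, hl⟩ := hcase.resolve_left hIoo
    rw [DeBranges.relSpectrum_relS0 he hs, mem_ofPred_eq] at hl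
    have hlr : ((l.re : ℝ) : ℂ) = l :=
      Complex.ext rfl (DeBranges.im_eq_zero_of_s_eq_zero hl).symm
    refine ⟨l.re, ?_⟩
    -- At an endpoint, `s_γ` is `s_0` or `s_π = -s_0`, so any point of `spec(S_0)` is a zero.
    rw [hlr]
    rcases hγc.1.eq_or_lt with h | h
    · rw [← h, hl]
    · rw [le_antisymm hγc.2 (not_lt.1 fun h' => hIoo ⟨h, h'⟩), DeBranges.s_pi, hl, neg_zero]
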